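/- Let $d,e\ge 0$ be integers. For a Lipschitz path $x:[a,b]\to\mathbb{R}^d$ write $x_{s,t}=x_t-x_s$, $\int_s^t|dx|=\int_s^t|\dot x_r|\,dr$ (Euclidean norm), and let $$S_N(x)_{s,t}=1+\sum_{k=1}^N\Big(\int_{s<u_1<\dots<u_k<t}dx^{i_1}_{u_1}\cdots dx^{i_k}_{u_k}\Big)_{1\le i_1,\dots,i_k\le d}\in\bigoplus_{k=0}^N(\mathbb{R}^d)^{\otimes k}$$ be its step-$N$ signature over $[s,t]$. Let $\|\mathbf g\|$ be the infimum of $\int_0^1|\dot\gamma_r|\,dr$ over all Lipschitz $\gamma:[0,1]\to\mathbb{R}^d$ with $\gamma_0=0$ and $S_N(\gamma)_{0,1}=\mathbf g$ (the Carnot–Carathéodory norm), and put $$\|S_N(x)\|_{1/p\text{-Höl}}=\sup_{0\le s<t\le1}\frac{\|S_N(x)_{s,t}\|}{(t-s)^{1/p}} .$$ For an integer $N\ge1$, a vector field on $\mathbb{R}^e$ is in $\mathrm{Lip}^N(\mathbb{R}^e)$ if it is $N-1$ times continuously differentiable, its derivatives of orders $0,\dots,N-1$ are bounded, and its derivative of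 order $N-1$ is Lipschitz. Given $V=(V_1,\dots,V_d)$ in $\mathrm{Lip}^N(\mathbb{R}^e)$, let $\pi(s,\eta;x)$ be the solution of $dy=\sum_{i=1}^dV_i(y)\,dx^i$ with $y_s=\eta$, write $\pi(s,\eta;x)_{s,t}$ for its increment over $[s,t]$, and, with vector fields acting as first order differential operators and $H$ the identity map of $\mathbb{R}^e$, let $$I^{\eta,N,\mathbf g}=\sum_{k=1}^N\sum_{i_1,\dots,i_k}V_{i_1}\cdots V_{i_k}H(\eta)\,\mathbf g^{k,i_1,\dots,i_k}.$$ **Lemma (Generalized Davie Lemma).** Let $p\ge1$, let $N>p-1$ be an integer, let $V_1,\dots,V_d\in\mathrm{Lip}^N(\mathbb{R}^e)$, let $M_1\ge0$ and $M_2\in\mathbb{R}$, and put $\theta=(N+1)/p$. (a) There is a constant $C>0$, depending only on $p,N,M_1,M_2$ and $V_1,\dots,V_d$ (in particular not on the Lipschitz norm of $x$), such that for every Lipschitz path $x:[0,1]\to\mathbb{R}^d$ with lift $\mathbf x=S_N(x)$ satisfying $\|\mathbf x\|_{1/p\text{-Höl}}\le M_1$, every $y_0\in\mathbb{R}^e$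 with $|y_0|\le M_2$, and $y=\pi(0,y_0;x)$, $$|y_t-y_s|<C\,(t-s)^{1/p}\qquad(0\le s<t\le1),$$ $$\big|(y_t-y_s)-I^{y_s,N,\mathbf x_{s,t}}\big|\le C\,(t-s)^{\theta}\qquad(0\le s\le t\le1).$$ (b) For every $K>0$ there is a constant $C'>0$, depending only on $p,N,M_1,M_2,K$ and $V_1,\dots,V_d$, such that for all $x,y_0,y$ as in (a), all $0\le s\le t\le1$, and every Lipschitz path $x^{s,t}:[s,t]\to\mathbb{R}^d$ with $S_N(x^{s,t})_{s,t}=\mathbf x_{s,t}$ and $\int_s^t|dx^{s,t}|\le KM_1(t-s)^{1/p}$, $$\big|(y_t-y_s)-\pi(s,y_s;x^{s,t})_{s,t}\big|\le C'\,(t-s)^{\theta}.$$ -/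

import Mathlib

open Set MeasureTheory
open scoped ENNReal NNReal

noncomputable section

namespace EulerRDE

/-- `ℝⁿ` with its Euclidean norm. -/
abbrev Vec (n : ℕ) : Type := EuclideanSpace ℝ (Fin n)

/-- The restriction of `x` to `[s, t]` is a Lipschitz path. Values of `x` outside `[s, t]` are
irrelevant here and in everything below. -/
def IsLipschitzPath {n : ℕ} (x : ℝ → Vec n) (s t : ℝ) : Prop :=
  ∃ L : ℝ≥0, LipschitzOnWith L x (Icc s t)

/-- The length `∫_s^t |dx_r| = ∫_s^t |ẋ_r| dr` of a Lipschitz path (which is differentiable almost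
everywhere on `[s, t]`). -/
def pathLength {n : ℕ} (x : ℝ → Vec n) (s t : ℝ) : ℝ :=
  ∫ r in s..t, ‖deriv x r‖

/-- The iterated integral
`∫_s^t ∫_s^{u_k} ⋯ ∫_s^{u_2} dx^{i_1}_{u_1} ⋯ dx^{i_k}_{u_k}` for the word `I = (i_1, …, i_k)`,
as a function of the upper limit `t`; the integration in the last letter is outermost. -/
def iterInt {d : ℕ} (x : ℝ → Vec d) (s : ℝ) : (k : ℕ) → (Fin k → Fin d) → ℝ → ℝ
  | 0, _, _ => 1
  | k + 1, I, t => ∫ u in s..t, iterInt x s k (Fin.init I) u * deriv x u (I (Fin.last k))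

/-- The truncated tensor algebra `⊕_{k=0}^N (ℝ^d)^{⊗ k}`, an element `g` being given by its
coordinates `g^{k, i_1, …, i_k}`. -/
abbrev TruncTensor (d N : ℕ) : Type :=
  (k : Fin (N + 1)) → (Fin (k : ℕ) → Fin d) → ℝ

/-- The step-`N` signature `S_N(x)_{s,t}` of the path segment `x|_{[s,t]}`. -/
def signature {d : ℕ} (N : ℕ) (x : ℝ → Vec d) (s t : ℝ) : TruncTensor d N :=
  fun k I => iterInt x s (k : ℕ) I t

/-- The Carnot–Carathéodory norm `‖g‖`: the infimum of the lengths of the Lipschitz paths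
`γ : [0,1] → ℝ^d` with `γ(0) = 0` and `S_N(γ)_{0,1} = g`. It is `∞` if there is no such path,
that is, if `g` does not belong to the step-`N` free nilpotent group. -/
def ccNorm {d N : ℕ} (g : TruncTensor d N) : ℝ≥0∞ :=
  ⨅ (γ : ℝ → Vec d) (_ : IsLipschitzPath γ 0 1) (_ : γ 0 = 0) (_ : signature N γ 0 1 = g),
    ENNReal.ofReal (pathLength γ 0 1)

/-- The homogeneous `1/p`-Hölder norm `sup_{0 ≤ s < t ≤ 1} ‖X_{s,t}‖ / (t - s)^{1/p}`. -/
def holderNorm {d N : ℕ} (p : ℝ) (X : ℝ → ℝ → TruncTensor d N) : ℝ≥0∞ :=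
  ⨆ (s : ℝ) (t : ℝ) (_ : 0 ≤ s) (_ : s < t) (_ : t ≤ 1),
    ccNorm (X s t) / ENNReal.ofReal ((t - s) ^ (1 / p))

/-- The class `Lip^N` of vector fields for an integer `N ≥ 1`: the derivatives up to order `N - 1`
exist and are continuous and bounded (the vector field itself included), and the one of order
`N - 1` is Lipschitz continuous. For `N = 1` these are the bounded Lipschitz vector fields. Every
vector field with continuous and bounded derivatives up to order `N` belongs to this class. -/
structure IsLip {e : ℕ} (N : ℕ) (V : Vec e → Vec e) : Prop where
  contDiff : ContDiff ℝ ((N - 1 : ℕ) : ℕ∞) V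
  bounded : ∃ B : ℝ, ∀ k : ℕ, k ≤ N - 1 → ∀ y, ‖iteratedFDeriv ℝ k V y‖ ≤ B
  lipschitz : ∃ L : ℝ≥0, LipschitzWith L (iteratedFDeriv ℝ (N - 1) V)

/-- `y` is the solution `π(s, y₀; x)` on `[s, t]` of `dy = ∑ i, V_i(y) dx^i`, `y_s = y₀`. -/
def IsSolution {d e : ℕ} (V : Fin d → Vec e → Vec e) (x : ℝ → Vec d) (s t : ℝ) (y₀ : Vec e)
    (y : ℝ → Vec e) : Prop :=
  ContinuousOn y (Icc s t) ∧
    ∀ r ∈ Icc s t, y r = y₀ + ∫ u in s..r, ∑ i, deriv x u i • V i (y u)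

/-- `V_{i_1} ⋯ V_{i_k} H`, where `H` is the identity function of `ℝ^e` and a vector field `W` acts
on functions as the first order differential operator `(W f)(y) = Df(y) W(y)`. -/
def wordField {d e : ℕ} (V : Fin d → Vec e → Vec e) : (k : ℕ) → (Fin k → Fin d) → Vec e → Vec e
  | 0, _ => fun y => y
  | k + 1, I => fun y => fderiv ℝ (wordField V k (Fin.tail I)) y (V (I 0) y)

/-- The increment `I[y, N, g] = ∑_{k=1}^N ∑_{i_1,…,i_k} V_{i_1} ⋯ V_{i_k} H(y) g^{k,i_1,…,i_k}`
of the step-`N` Euler scheme. The index `k : Fin N` stands for tensor level `k + 1`. -/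
def eulerIncrement {d e N : ℕ} (V : Fin d → Vec e → Vec e) (y : Vec e) (g : TruncTensor d N) :
    Vec e :=
  ∑ k : Fin N, ∑ I : Fin (k.succ : Fin (N + 1)) → Fin d, g k.succ I • wordField V k.succ I y

end EulerRDE

end

open EulerRDE

namespace EulerRDE

/-! Write N = n + 1 and let Φ_{s,t}(η) = η + I^{η,N,x_{s,t}} be one Euler step (`eulerStep`). The
core is a bound |y_t − Φ_{s,t}(y_s)| ≤ C (t−s)^θ whose constant sees x only through the bound on its
lift (`exists_norm_sub_eulerStep_le`). Part (a) then follows from the size of the Euler increment.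
For part (b), a path with the same signature has the same Euler step, and its own solution stays
near that step by a Taylor estimate in its length (`exists_norm_solution_sub_expand_le`).

The core bound is Davie's argument for G_{s,t} = |y_t − Φ_{s,t}(y_s)|. If each Φ is Lipschitz with
constant 1 + O((t−s)^{1/p}) and Φ_{t,u} ∘ Φ_{s,t} differs from Φ_{s,u} by O((u−s)^θ), then G is
almost additive. Since θ > 1, bisection contracts the constant in a bound G ≤ D (t−s)^θ on short
intervals. The Lipschitz norm of x is used only to know that some finite D exists; iteration removes
that D (`exists_forall_isAlmostAdditive_le`).

The almost flow property (`exists_norm_eulerStep_eulerStep_sub_le`) comes from Chen's identity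
(`expand_expand`) and a Taylor expansion of each V_I H at Φ_{s,t}(η). The latter needs a curve from
η to Φ_{s,t}(η) of controlled length. A short path γ with the signature of x over [s,t] supplies it:
the Euler curve along γ ends at Φ_{s,t}(η) and solves the equation up to a high power of the length
of γ (`exists_isApproxSolution_euler`). Thus neither existence nor stability of solutions along γ is
needed. -/

/-- The maps with bounded derivatives up to order `m`, the last of which is Lipschitz, described by
recursion on `m`. -/
def Reg {E : Type} [NormedAddCommGroup E] [NormedSpace ℝ E] :
    ℕ → ∀ (F : Type) [NormedAddCommGroup F] [NormedSpace ℝ F], (E → F) → Prop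
  | 0, _, _, _, f => (∃ B : ℝ, ∀ y, ‖f y‖ ≤ B) ∧ ∃ L : ℝ≥0, LipschitzWith L f
  | m + 1, F, _, _, f =>
    (∃ B : ℝ, ∀ y, ‖f y‖ ≤ B) ∧ Differentiable ℝ f ∧ Reg m (E →L[ℝ] F) (fderiv ℝ f)

/-! ### Calculus of bounded functions with Lipschitz last derivative -/

section Reg

variable {E F G H : Type} [NormedAddCommGroup E] [NormedSpace ℝ E]
  [NormedAddCommGroup F] [NormedSpace ℝ F] [NormedAddCommGroup G] [NormedSpace ℝ G]
  [NormedAddCommGroup H] [NormedSpace ℝ H]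

lemma Reg.exists_bound {m : ℕ} {f : E → F} (hf : Reg m F f) : ∃ B : ℝ, ∀ y, ‖f y‖ ≤ B := by
  cases m with
  | zero => exact hf.1
  | succ m => exact hf.1

lemma Reg.exists_lipschitz {m : ℕ} {f : E → F} (hf : Reg m F f) :
    ∃ L : ℝ≥0, LipschitzWith L f := by
  cases m with
  | zero => exact hf.2
  | succ m =>
    obtain ⟨B, hB⟩ := hf.2.2.exists_bound
    refine ⟨B.toNNReal, lipschitzWith_of_nnnorm_fderiv_le hf.2.1 fun y => ?_⟩
    rw [← NNReal.coe_le_coe, coe_nnnorm]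
    exact (hB y).trans (Real.le_coe_toNNReal B)

lemma Reg.continuous {m : ℕ} {f : E → F} (hf : Reg m F f) : Continuous f := by
  obtain ⟨L, hL⟩ := hf.exists_lipschitz
  exact hL.continuous

lemma Reg.of_succ {m : ℕ} {f : E → F} (hf : Reg (m + 1) F f) : Reg m F f := by
  induction m generalizing F with
  | zero => exact ⟨hf.exists_bound, hf.exists_lipschitz⟩
  | succ m ih => exact ⟨hf.1, hf.2.1, ih hf.2.2⟩

lemma Reg.mono {m n : ℕ} (hmn : m ≤ n) {f : E → F} (hf : Reg n F f) : Reg m F f := by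
  induction n, hmn using Nat.le_induction with
  | base => exact hf
  | succ n _ ih => exact ih hf.of_succ

lemma Reg.add {m : ℕ} {f g : E → F} (hf : Reg m F f) (hg : Reg m F g) :
    Reg m F (fun y => f y + g y) := by
  have hb : ∃ B : ℝ, ∀ y, ‖f y + g y‖ ≤ B := by
    obtain ⟨B, hB⟩ := hf.exists_bound
    obtain ⟨B', hB'⟩ := hg.exists_bound
    exact ⟨B + B', fun y => norm_add_le_of_le (hB y) (hB' y)⟩
  induction m generalizing F with
  | zero =>
    obtain ⟨L, hL⟩ := hf.2
    obtain ⟨L', hL'⟩ := hg.2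
    exact ⟨hb, L + L', hL.add hL'⟩
  | succ m ih =>
    refine ⟨hb, hf.2.1.add hg.2.1, ?_⟩
    have h : fderiv ℝ (fun y => f y + g y) = fun y => fderiv ℝ f y + fderiv ℝ g y := by
      ext1 y
      exact fderiv_add (hf.2.1 y) (hg.2.1 y)
    rw [h]
    refine ih hf.2.2 hg.2.2 ?_
    obtain ⟨B, hB⟩ := hf.2.2.exists_bound
    obtain ⟨B', hB'⟩ := hg.2.2.exists_bound
    exact ⟨B + B', fun y => norm_add_le_of_le (hB y) (hB' y)⟩

/-- The product rule turns one bilinear pairing into two others, with values in spaces of linear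
maps, so the induction runs over all pairings and target spaces at once. -/
lemma Reg.bilinear {m : ℕ} (B : F →L[ℝ] G →L[ℝ] H) {f : E → F} {g : E → G}
    (hf : Reg m F f) (hg : Reg m G g) : Reg m H (fun y => B (f y) (g y)) := by
  induction m generalizing F G H with
  | zero =>
    obtain ⟨⟨K, hK⟩, L, hL⟩ := hf
    obtain ⟨⟨K', hK'⟩, L', hL'⟩ := hg
    have h0 : 0 ≤ K := (norm_nonneg _).trans (hK 0)
    refine ⟨⟨‖B‖ * K * K', fun y => (B.le_opNorm₂ _ _).trans ?_⟩,
      (‖B‖ * L * K' + ‖B‖ * K * L').toNNReal, LipschitzWith.of_dist_le_mul fun y z => ?_⟩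
    · gcongr
      exacts [hK y, hK' y]
    · refine le_trans ?_ (mul_le_mul_of_nonneg_right (Real.le_coe_toNNReal _) dist_nonneg)
      have e : B (f y) (g y) - B (f z) (g z) = B (f y - f z) (g y) + B (f z) (g y - g z) := by
        simp
      have h1 := hL.dist_le_mul y z
      have h2 := hL'.dist_le_mul y z
      rw [dist_eq_norm] at h1 h2
      rw [dist_eq_norm, e]
      calc _ ≤ ‖B‖ * ‖f y - f z‖ * ‖g y‖ + ‖B‖ * ‖f z‖ * ‖g y - g z‖ :=
            norm_add_le_of_le (B.le_opNorm₂ _ _) (B.le_opNorm₂ _ _)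
        _ ≤ ‖B‖ * (L * dist y z) * K' + ‖B‖ * K * (L' * dist y z) := by
            gcongr
            exacts [hK' y, hK z]
        _ = _ := by ring
  | succ m ih =>
    obtain ⟨K, hK⟩ := hf.exists_bound
    obtain ⟨K', hK'⟩ := hg.exists_bound
    have h0 : 0 ≤ K := (norm_nonneg _).trans (hK 0)
    refine ⟨⟨‖B‖ * K * K', fun y => (B.le_opNorm₂ _ _).trans ?_⟩, fun y => ?_, ?_⟩
    · gcongr
      exacts [hK y, hK' y]
    · exact (B.hasFDerivAt_of_bilinear (hf.2.1 y).hasFDerivAt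
        (hg.2.1 y).hasFDerivAt).differentiableAt
    · have h : fderiv ℝ (fun y => B (f y) (g y)) = fun y =>
          B.precompR E (f y) (fderiv ℝ g y) + B.precompL E (fderiv ℝ f y) (g y) := by
        ext1 y
        exact B.fderiv_of_bilinear (hf.2.1 y) (hg.2.1 y)
      rw [h]
      exact (ih _ hf.of_succ hg.2.2).add (ih _ hf.2.2 hg.of_succ)

lemma Reg.of_iteratedFDeriv {m : ℕ} {f : E → F} (hf : ContDiff ℝ m f)
    (hb : ∃ B : ℝ, ∀ k : ℕ, k ≤ m → ∀ y, ‖iteratedFDeriv ℝ k f y‖ ≤ B)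
    (hl : ∃ L : ℝ≥0, LipschitzWith L (iteratedFDeriv ℝ m f)) : Reg m F f := by
  obtain ⟨B, hB⟩ := hb
  have hB0 : ∃ B : ℝ, ∀ y, ‖f y‖ ≤ B :=
    ⟨B, fun y => by simpa using hB 0 (Nat.zero_le _) y⟩
  obtain ⟨L, hL⟩ := hl
  induction m generalizing F with
  | zero =>
    refine ⟨hB0, L, ?_⟩
    rw [iteratedFDeriv_zero_eq_comp] at hL
    intro y z
    have h := hL y z
    rwa [Function.comp_apply, Function.comp_apply, LinearIsometryEquiv.edist_map] at h
  | succ m ih =>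
    rw [Nat.cast_succ, contDiff_succ_iff_fderiv] at hf
    refine ⟨hB0, hf.1, ih hf.2.2 ?_ ⟨B, fun y => ?_⟩ ?_⟩
    · intro k hk y
      rw [norm_iteratedFDeriv_fderiv]
      exact hB (k + 1) (by omega) y
    · rw [← norm_iteratedFDeriv_zero (𝕜 := ℝ), norm_iteratedFDeriv_fderiv]
      exact hB 1 (by omega) y
    · intro y z
      have h := hL y z
      rwa [iteratedFDeriv_succ_eq_comp_right, iteratedFDeriv_succ_eq_comp_right,
        Function.comp_apply, Function.comp_apply, LinearIsometryEquiv.edist_map] at h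

end Reg

lemma IsLip.reg {e N : ℕ} {W : Vec e → Vec e} (hW : IsLip N W) : Reg (N - 1) (Vec e) W :=
  Reg.of_iteratedFDeriv (by exact_mod_cast hW.contDiff) hW.bounded hW.lipschitz

/-! ### Iterated vector fields -/

section wordOp

variable {d e : ℕ} (V : Fin d → Vec e → Vec e)

/-- The action of the vector field `W` on vector valued functions. -/
noncomputable def lieD (W : Vec e → Vec e) (f : Vec e → Vec e) : Vec e → Vec e :=
  fun y => fderiv ℝ f y (W y)

/-- `V_{i_1} ⋯ V_{i_k} f`. -/
noncomputable def wordOp (f : Vec e → Vec e) : (k : ℕ) → (Fin k → Fin d) → Vec e → Vec e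
  | 0, _ => f
  | k + 1, I => lieD (V (I 0)) (wordOp f k (Fin.tail I))

lemma wordField_eq_wordOp (k : ℕ) (I : Fin k → Fin d) :
    wordField V k I = wordOp V (fun y => y) k I := by
  induction k with
  | zero => rfl
  | succ k ih => simp only [wordField, wordOp, ih]; rfl

/-- Reconciles two recursions: `wordField` peels off the first letter, whereas iterated integrals
peel off the last. The last letter acts on f first, so it can be absorbed into f. -/
lemma wordOp_snoc (f : Vec e → Vec e) (k : ℕ) (J : Fin k → Fin d) (i : Fin d) :
    wordOp V f (k + 1) (Fin.snoc (α := fun _ => Fin d) J i) = wordOp V (lieD (V i) f) k J := by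
  induction k with
  | zero => rfl
  | succ k ih =>
    have h : Fin.tail (Fin.snoc (α := fun _ => Fin d) J i) =
        Fin.snoc (α := fun _ => Fin d) (Fin.tail J) i := by
      ext1 j
      refine Fin.lastCases ?_ (fun j => ?_) j
      · simp only [Fin.tail, Fin.snoc_last, Fin.succ_last]
      · simp only [Fin.tail, Fin.snoc_castSucc, Fin.succ_castSucc]
    have h0 : Fin.snoc (α := fun _ => Fin d) J i 0 = J 0 :=
      Fin.snoc_castSucc (α := fun _ => Fin d) i J 0
    rw [wordOp, h0, h, ih]
    rfl

lemma Reg.lieD {m : ℕ} {W f : Vec e → Vec e} (hW : Reg m (Vec e) W)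
    (hf : Reg (m + 1) (Vec e) f) : Reg m (Vec e) (lieD W f) :=
  Reg.bilinear (ContinuousLinearMap.id ℝ (Vec e →L[ℝ] Vec e)) hf.2.2 hW

/-- Words start at length one because the identity H is unbounded, while V_i H = V_i has full
regularity. Each further letter costs one derivative. -/
lemma Reg.wordField {n : ℕ} (hV : ∀ i, Reg n (Vec e) (V i)) (k : ℕ) (hk : k ≤ n)
    (I : Fin (k + 1) → Fin d) : Reg (n - k) (Vec e) (wordField V (k + 1) I) := by
  induction k with
  | zero =>
    have h : EulerRDE.wordField V 1 I = V (I 0) := by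
      ext1 y
      simp [EulerRDE.wordField]
    rw [h]
    exact hV _
  | succ k ih =>
    have h := ih (by omega) (Fin.tail I)
    rw [show n - k = n - (k + 1) + 1 by omega] at h
    exact Reg.lieD ((hV (I 0)).mono (Nat.sub_le _ _)) h

end wordOp

lemma intervalIntegrable_fun_sum {ι F : Type} [NormedAddCommGroup F] (S : Finset ι)
    {g : ι → ℝ → F} {a b : ℝ} (h : ∀ i ∈ S, IntervalIntegrable (g i) volume a b) :
    IntervalIntegrable (fun u => ∑ i ∈ S, g i u) volume a b :=
  ⟨integrable_finsetSum S fun i hi => (h i hi).1, integrable_finsetSum S fun i hi => (h i hi).2⟩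

/-! ### Lipschitz paths, iterated integrals and integrals against dx -/

section Path

variable {d e : ℕ} {x : ℝ → Vec d} {a b : ℝ}

lemma IsLipschitzPath.mono (hx : IsLipschitzPath x a b) {s t : ℝ} (hs : a ≤ s) (ht : t ≤ b) :
    IsLipschitzPath x s t :=
  hx.imp fun _ hL => LipschitzOnWith.mono hL (Icc_subset_Icc hs ht)

lemma IsLipschitzPath.exists_deriv_bound (hx : IsLipschitzPath x a b) :
    ∃ L : ℝ, 0 ≤ L ∧ ∀ u ∈ Ioo a b, ‖deriv x u‖ ≤ L := by
  obtain ⟨L, hL⟩ := hx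
  exact ⟨L, L.2, fun u hu => norm_deriv_le_of_lipschitzOn (Icc_mem_nhds hu.1 hu.2) hL⟩

lemma IsLipschitzPath.intervalIntegrable_deriv (hx : IsLipschitzPath x a b) (hab : a ≤ b) :
    IntervalIntegrable (deriv x) volume a b := by
  obtain ⟨L, -, hL⟩ := hx.exists_deriv_bound
  rw [intervalIntegrable_iff_integrableOn_Ioo_of_le hab]
  refine Measure.integrableOn_of_bounded (M := L) (by simp)
    (measurable_deriv x).aestronglyMeasurable ?_
  exact (ae_restrict_iff' measurableSet_Ioo).2 (Filter.Eventually.of_forall hL)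

lemma IsLipschitzPath.intervalIntegrable_coord (hx : IsLipschitzPath x a b) (hab : a ≤ b)
    (i : Fin d) : IntervalIntegrable (fun u => deriv x u i) volume a b := by
  have h := hx.intervalIntegrable_deriv hab
  rw [intervalIntegrable_iff] at h ⊢
  exact (EuclideanSpace.proj (𝕜 := ℝ) i).integrable_comp h

lemma pathLength_nonneg (hab : a ≤ b) : 0 ≤ pathLength x a b :=
  intervalIntegral.integral_nonneg hab fun _ _ => norm_nonneg _

lemma IsLipschitzPath.pathLength_mono (hx : IsLipschitzPath x a b) {r : ℝ} (har : a ≤ r)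
    (hrb : r ≤ b) : pathLength x a r ≤ pathLength x a b :=
  intervalIntegral.integral_mono_interval le_rfl har hrb
    (Filter.Eventually.of_forall fun _ => norm_nonneg _)
    (hx.intervalIntegrable_deriv (har.trans hrb)).norm

lemma IsLipschitzPath.exists_pathLength_le (hx : IsLipschitzPath x a b) :
    ∃ L : ℝ, 0 ≤ L ∧ ∀ s t, a ≤ s → s ≤ t → t ≤ b → pathLength x s t ≤ L * (t - s) := by
  obtain ⟨L, hL0, hL⟩ := hx.exists_deriv_bound
  refine ⟨L, hL0, fun s t hs hst ht => ?_⟩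
  have h : ‖∫ r in s..t, ‖deriv x r‖‖ ≤ L * |t - s| := by
    refine intervalIntegral.norm_integral_le_of_norm_le_const_ae ?_
    have hb : ∀ᵐ r : ℝ, r ≠ t := by simp [ae_iff, measure_singleton]
    filter_upwards [hb] with r hr hrt
    rw [uIoc_of_le hst] at hrt
    rw [norm_norm]
    exact hL r ⟨hs.trans_lt hrt.1, (lt_of_le_of_ne hrt.2 hr).trans_le ht⟩
  rw [abs_of_nonneg (sub_nonneg.2 hst)] at h
  exact (le_abs_self _).trans h

lemma continuousOn_iterInt (hx : IsLipschitzPath x a b) (hab : a ≤ b) (k : ℕ)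
    (I : Fin k → Fin d) : ContinuousOn (iterInt x a k I) (Icc a b) ∧
      IntervalIntegrable (fun u => iterInt x a k I u) volume a b := by
  have key : ContinuousOn (iterInt x a k I) (Icc a b) := by
    induction k with
    | zero => exact continuousOn_const
    | succ k ih =>
      rw [← uIcc_of_le hab] at ih ⊢
      exact intervalIntegral.continuousOn_primitive_interval'
        ((hx.intervalIntegrable_coord hab _).continuousOn_mul (ih _)) left_mem_uIcc
  refine ⟨key, ?_⟩
  rw [← uIcc_of_le hab] at key
  exact key.intervalIntegrable

lemma abs_iterInt_le (hx : IsLipschitzPath x a b) (hab : a ≤ b) (k : ℕ)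
    (I : Fin k → Fin d) {r : ℝ} (hr : r ∈ Icc a b) :
    |iterInt x a k I r| ≤ pathLength x a b ^ k := by
  induction k generalizing r with
  | zero => simp [iterInt]
  | succ k ih =>
    have hn := ((hx.mono le_rfl hr.2).intervalIntegrable_deriv hr.1).norm
    have h0 : 0 ≤ pathLength x a b := pathLength_nonneg hab
    rw [iterInt, ← Real.norm_eq_abs]
    calc _ ≤ ∫ u in a..r, pathLength x a b ^ k * ‖deriv x u‖ := by
          refine intervalIntegral.norm_integral_le_of_norm_le hr.1
            (Filter.Eventually.of_forall fun u hu => ?_) (hn.const_mul _)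
          rw [norm_mul, Real.norm_eq_abs]
          exact mul_le_mul (ih _ ⟨hu.1.le, hu.2.trans hr.2⟩) (PiLp.norm_apply_le _ _)
            (norm_nonneg _) (by positivity)
      _ = pathLength x a b ^ k * pathLength x a r := by
          rw [intervalIntegral.integral_const_mul]
          rfl
      _ ≤ _ := by
          rw [pow_succ]
          exact mul_le_mul_of_nonneg_left (hx.pathLength_mono hr.1 hr.2) (by positivity)

lemma intervalIntegrable_drive (hx : IsLipschitzPath x a b) (hab : a ≤ b)
    {A : Fin d → ℝ → Vec e} (hA : ∀ i, ContinuousOn (A i) (Icc a b)) :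
    IntervalIntegrable (fun u => ∑ i, deriv x u i • A i u) volume a b := by
  rw [← uIcc_of_le hab] at hA
  exact intervalIntegrable_fun_sum _ fun i _ =>
    (hx.intervalIntegrable_coord hab i).smul_continuousOn (hA i)

lemma norm_drive_le (hx : IsLipschitzPath x a b) {A : Fin d → ℝ → Vec e} {K : ℝ} (hK : 0 ≤ K)
    (hA : ∀ i, ∀ u ∈ Icc a b, ‖A i u‖ ≤ K) {r : ℝ} (hr : r ∈ Icc a b) :
    ‖∫ u in a..r, ∑ i, deriv x u i • A i u‖ ≤ d * K * pathLength x a b := by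
  have hn := ((hx.mono le_rfl hr.2).intervalIntegrable_deriv hr.1).norm
  calc _ ≤ ∫ u in a..r, d * K * ‖deriv x u‖ := by
        refine intervalIntegral.norm_integral_le_of_norm_le hr.1
          (Filter.Eventually.of_forall fun u hu => ?_) (hn.const_mul _)
        refine (norm_sum_le_of_le (n := fun _ => K * ‖deriv x u‖) _ fun i _ => ?_).trans ?_
        · rw [norm_smul, mul_comm]
          exact mul_le_mul (hA i u ⟨hu.1.le, hu.2.trans hr.2⟩) (PiLp.norm_apply_le _ _)
            (norm_nonneg _) hK
        · simp [mul_assoc]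
    _ = d * K * pathLength x a r := by
        rw [intervalIntegral.integral_const_mul]
        rfl
    _ ≤ _ := mul_le_mul_of_nonneg_left (hx.pathLength_mono hr.1 hr.2) (by positivity)

lemma norm_drive_sub_le {L K : ℝ} (hL : ∀ u ∈ Ioo a b, ‖deriv x u‖ ≤ L) (hL0 : 0 ≤ L)
    {A : Fin d → ℝ → Vec e} (hA : ∀ i, ∀ u ∈ Icc a b, ‖A i u‖ ≤ K) {s t : ℝ} (hs : s ∈ Icc a b)
    (ht : t ∈ Icc a b) : ‖∫ u in s..t, ∑ i, deriv x u i • A i u‖ ≤ d * (L * K) * |t - s| := by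
  refine intervalIntegral.norm_integral_le_of_norm_le_const_ae ?_
  have hb : ∀ᵐ r : ℝ, r ≠ b := by simp [ae_iff, measure_singleton]
  filter_upwards [hb] with r hr hrt
  have h1 : a < r := (le_min hs.1 ht.1).trans_lt hrt.1
  have h2 : r ≤ b := hrt.2.trans (max_le hs.2 ht.2)
  refine (norm_sum_le_of_le (n := fun _ => L * K) _ fun i _ => ?_).trans ?_
  · rw [norm_smul]
    exact mul_le_mul ((PiLp.norm_apply_le _ _).trans (hL r ⟨h1, lt_of_le_of_ne h2 hr⟩))
      (hA i r ⟨h1.le, h2⟩) (norm_nonneg _) hL0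
  · simp

/-- The chain rule along an absolutely continuous curve. -/
lemma comp_drive_eq (hx : IsLipschitzPath x a b) (hab : a ≤ b) {A : Fin d → ℝ → Vec e}
    (hA : ∀ i, ContinuousOn (A i) (Icc a b)) {η : Vec e} {c : ℝ → Vec e}
    (hc : ∀ r ∈ Icc a b, c r = η + ∫ u in a..r, ∑ i, deriv x u i • A i u)
    {m : ℕ} {f : Vec e → Vec e} (hf : Reg (m + 1) (Vec e) f) {r : ℝ} (hr : r ∈ Icc a b) :
    f (c r) = f η + ∫ u in a..r, ∑ i, deriv x u i • fderiv ℝ f (c u) (A i u) := by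
  obtain ⟨L, hL0, hL⟩ := hx.exists_deriv_bound
  have hlip : ∀ B : Fin d → ℝ → Vec e, (∀ i, ContinuousOn (B i) (Icc a b)) →
      ∃ K : ℝ≥0, LipschitzOnWith K (fun r => ∫ u in a..r, ∑ i, deriv x u i • B i u)
        (Icc a b) := by
    intro B hB
    have hbd : ∃ K : ℝ, ∀ i, ∀ u ∈ Icc a b, ‖B i u‖ ≤ K := by
      choose K hK using fun i => isCompact_Icc.exists_bound_of_continuousOn (hB i)
      exact ⟨∑ i, |K i|, fun i u hu => (hK i u hu).trans ((le_abs_self _).trans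
        (Finset.single_le_sum (f := fun i => |K i|) (fun _ _ => abs_nonneg _)
          (Finset.mem_univ i)))⟩
    obtain ⟨K, hK⟩ := hbd
    refine ⟨(d * (L * K)).toNNReal, LipschitzOnWith.of_dist_le_mul fun t ht s hs => ?_⟩
    have hint := intervalIntegrable_drive hx hab hB
    have hsub : ∀ r ∈ Icc a b,
        IntervalIntegrable (fun u => ∑ i, deriv x u i • B i u) volume a r := fun r hr =>
      hint.mono_set (by rw [uIcc_of_le hab, uIcc_of_le hr.1]; exact Icc_subset_Icc_right hr.2)
    rw [dist_eq_norm, intervalIntegral.integral_interval_sub_left (hsub t ht) (hsub s hs),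
      Real.dist_eq]
    exact (norm_drive_sub_le hL hL0 hK hs ht).trans
      (mul_le_mul_of_nonneg_right (Real.le_coe_toNNReal _) (abs_nonneg _))
  obtain ⟨K, hK⟩ := hlip A hA
  have hclip : LipschitzOnWith K c (Icc a b) := by
    refine LipschitzOnWith.of_dist_le_mul fun t ht s hs => ?_
    rw [hc t ht, hc s hs, dist_add_left]
    exact hK.dist_le_mul t ht s hs
  set B : Fin d → ℝ → Vec e := fun i u => fderiv ℝ f (c u) (A i u) with hBdef
  have hB : ∀ i, ContinuousOn (B i) (Icc a b) := fun i =>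
    (hf.2.2.continuous.comp_continuousOn hclip.continuousOn).clm_apply (hA i)
  obtain ⟨K', hK'⟩ := hlip B hB
  obtain ⟨Lf, hLf⟩ := hf.exists_lipschitz
  have hfc : LipschitzOnWith (Lf * K) (fun r => f (c r)) (Icc a b) :=
    hLf.comp_lipschitzOnWith hclip
  have hu : uIcc a b = Icc a b := uIcc_of_le hab
  -- Both sides are Lipschitz in r, so their difference is absolutely continuous; its derivative
  -- vanishes almost everywhere, hence it is constant.
  have hac : AbsolutelyContinuousOnInterval
      ((fun r => f (c r)) - fun r => ∫ u in a..r, ∑ i, deriv x u i • B i u) a b :=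
    AbsolutelyContinuousOnInterval.sub
      (LipschitzOnWith.absolutelyContinuousOnInterval (by rwa [hu]))
      (LipschitzOnWith.absolutelyContinuousOnInterval (by rwa [hu]))
  obtain ⟨C, hC⟩ := hac.const_of_ae_hasDerivAt_zero (by
    have hna : ∀ᵐ r : ℝ, r ≠ a := by simp [ae_iff, measure_singleton]
    have hnb : ∀ᵐ r : ℝ, r ≠ b := by simp [ae_iff, measure_singleton]
    filter_upwards [hna, hnb, (intervalIntegrable_drive hx hab hA).ae_hasDerivAt_integral,
      (intervalIntegrable_drive hx hab hB).ae_hasDerivAt_integral] with r hra hrb h1 h2 hr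
    have hA' := h1 hr a left_mem_uIcc
    have hB' := h2 hr a left_mem_uIcc
    rw [hu] at hr
    have hmem : Icc a b ∈ nhds r :=
      Icc_mem_nhds (lt_of_le_of_ne hr.1 (Ne.symm hra)) (lt_of_le_of_ne hr.2 hrb)
    have hc' : HasDerivAt c (∑ i, deriv x r i • A i r) r := by
      refine (hA'.const_add η).congr_of_eventuallyEq ?_
      filter_upwards [hmem] with t ht using hc t ht
    have h := ((hf.2.1 (c r)).hasFDerivAt.comp_hasDerivAt r hc').sub hB'
    have e : fderiv ℝ f (c r) (∑ i, deriv x r i • A i r) - ∑ i, deriv x r i • B i r = 0 := by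
      simp [hBdef, map_sum]
    rw [e] at h
    exact h)
  rw [hu] at hC
  have h1 := hC r hr
  have h2 := hC a (left_mem_Icc.2 hab)
  have h3 := hc a (left_mem_Icc.2 hab)
  simp only [Pi.sub_apply, intervalIntegral.integral_same, sub_zero, add_zero] at h1 h2 h3
  rw [← h3, h2, ← h1, sub_add_cancel]

end Path

/-! ### Taylor expansions along paths and Chen's identity -/

section Expansion

variable {d e : ℕ} (V : Fin d → Vec e → Vec e)

/-- The expansion `∑_{k ≤ m} ∑_{|I| = k} S^I_{t,u} E_{m - k}(V_I f)` along the path `x`. The choice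
`E_j(g) = g(η)` gives the Taylor expansion of order `m` of `f` at `η` along solutions. -/
noncomputable def expand (x : ℝ → Vec d) (t : ℝ) (E : ℕ → (Vec e → Vec e) → Vec e) (m : ℕ)
    (f : Vec e → Vec e) (u : ℝ) : Vec e :=
  ∑ k ∈ Finset.range (m + 1), ∑ I : Fin k → Fin d,
    iterInt x t k I u • E (m - k) (wordOp V f k I)

variable {x : ℝ → Vec d} {t b : ℝ}

lemma continuousOn_expand (hx : IsLipschitzPath x t b) (htb : t ≤ b)
    (E : ℕ → (Vec e → Vec e) → Vec e) (m : ℕ) (f : Vec e → Vec e) :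
    ContinuousOn (expand V x t E m f) (Icc t b) :=
  continuousOn_finsetSum _ fun k _ => continuousOn_finsetSum _ fun I _ =>
    (continuousOn_iterInt hx htb k I).1.smul continuousOn_const

lemma sum_snoc {M : Type} [AddCommMonoid M] (k : ℕ) (F : (Fin (k + 1) → Fin d) → M) :
    ∑ I : Fin (k + 1) → Fin d, F I =
      ∑ i : Fin d, ∑ J : Fin k → Fin d, F (Fin.snoc (α := fun _ => Fin d) J i) := by
  rw [← (Fin.snocEquiv fun _ => Fin d).sum_comp, Fintype.sum_prod_type]
  rfl

/-- Splitting off the last letter of each nonempty word gives an integral equation of the same shape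
as the chain rule for f along a driven curve. The two can therefore be compared by induction on the
order. -/
lemma expand_succ (hx : IsLipschitzPath x t b) {u : ℝ} (hu : u ∈ Icc t b)
    (E : ℕ → (Vec e → Vec e) → Vec e) (m : ℕ) (f : Vec e → Vec e) :
    expand V x t E (m + 1) f u =
      E (m + 1) f + ∫ r in t..u, ∑ i, deriv x r i • expand V x t E m (lieD (V i) f) r := by
  have hx' := hx.mono le_rfl hu.2
  have hint : ∀ (i : Fin d) (k : ℕ) (J : Fin k → Fin d) (w : Vec e),
      IntervalIntegrable (fun r => (iterInt x t k J r * deriv x r i) • w) volume t u := by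
    intro i k J w
    have h := (continuousOn_iterInt hx' hu.1 k J).1
    rw [← uIcc_of_le hu.1] at h
    have h' := (hx'.intervalIntegrable_coord hu.1 i).continuousOn_mul h
    exact ⟨h'.1.smul_const w, h'.2.smul_const w⟩
  have hR : ∫ r in t..u, ∑ i, deriv x r i • expand V x t E m (lieD (V i) f) r =
      ∑ i, ∑ k ∈ Finset.range (m + 1), ∑ J : Fin k → Fin d,
        (∫ r in t..u, iterInt x t k J r * deriv x r i) • E (m - k) (wordOp V (lieD (V i) f) k J) := by
    have e1 : ∀ r, ∑ i, deriv x r i • expand V x t E m (lieD (V i) f) r =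
        ∑ i, ∑ k ∈ Finset.range (m + 1), ∑ J : Fin k → Fin d,
          (iterInt x t k J r * deriv x r i) • E (m - k) (wordOp V (lieD (V i) f) k J) := by
      intro r
      simp only [expand, Finset.smul_sum, smul_smul, mul_comm]
    simp only [e1, ← intervalIntegral.integral_smul_const]
    rw [intervalIntegral.integral_finsetSum]
    · refine Finset.sum_congr rfl fun i _ => ?_
      rw [intervalIntegral.integral_finsetSum]
      · refine Finset.sum_congr rfl fun k _ => ?_
        rw [intervalIntegral.integral_finsetSum]
        exact fun J _ => hint i k J _
      · exact fun k _ => intervalIntegrable_fun_sum _ fun J _ => hint i k J _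
    · exact fun i _ => intervalIntegrable_fun_sum _ fun k _ =>
        intervalIntegrable_fun_sum _ fun J _ => hint i k J _
  rw [hR, expand, Finset.sum_range_succ', add_comm]
  congr 1
  · rw [Fintype.sum_unique]
    simp [iterInt, wordOp]
  · rw [Finset.sum_comm]
    refine Finset.sum_congr rfl fun k _ => ?_
    rw [sum_snoc]
    refine Finset.sum_congr rfl fun i _ => Finset.sum_congr rfl fun J _ => ?_
    rw [wordOp_snoc, iterInt, Fin.snoc_last, Fin.init_snoc, Nat.add_sub_add_right]

lemma expand_zero (E : ℕ → (Vec e → Vec e) → Vec e) (f : Vec e → Vec e) (u : ℝ) :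
    expand V x t E 0 f u = E 0 f := by
  simp [expand, iterInt, wordOp]

/-- Chen's identity, in terms of expansions. -/
lemma expand_expand {s u : ℝ} (hst : s ≤ t) (htu : t ≤ u) (hx : IsLipschitzPath x s u)
    (E : ℕ → (Vec e → Vec e) → Vec e) (m : ℕ) (f : Vec e → Vec e) :
    expand V x t (fun j g => expand V x s E j g t) m f u = expand V x s E m f u := by
  -- With E arbitrary, the inner expansion is itself an admissible E, so no tensor product is
  -- needed: both sides satisfy the equation of `expand_succ`, once the integral over [s, u] is cut
  -- at t.
  induction m generalizing f u with
  | zero => simp only [expand_zero]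
  | succ m ih =>
    have hxt := hx.mono hst le_rfl
    have hc : ∀ i, ContinuousOn (expand V x s E m (lieD (V i) f)) (Icc s u) :=
      fun i => continuousOn_expand V hx (hst.trans htu) E m _
    rw [expand_succ V hxt (right_mem_Icc.2 htu), expand_succ V hx ⟨hst, htu⟩,
      expand_succ V hx (right_mem_Icc.2 (hst.trans htu)), add_assoc]
    congr 1
    rw [← intervalIntegral.integral_add_adjacent_intervals (b := t)
      (intervalIntegrable_drive (hx.mono le_rfl htu) hst
        fun i => (hc i).mono (Icc_subset_Icc_right htu))
      (intervalIntegrable_drive hxt htu fun i => (hc i).mono (Icc_subset_Icc_left hst))]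
    congr 1
    refine intervalIntegral.integral_congr fun r hr => ?_
    rw [uIcc_of_le htu] at hr
    exact Finset.sum_congr rfl fun i _ => by
      rw [ih hr.1 (hx.mono le_rfl hr.2)]

end Expansion

/-! ### Taylor estimates along approximate solutions -/

section Approx

variable {d e : ℕ} (V : Fin d → Vec e → Vec e)

/-- `c` starts at `η`, is driven by `x` through the coefficients `A_i`, and these agree with
`V_i(c)` up to `D` times the powers of order at most `m` of the length of `x`. -/
structure IsApproxSolution (x : ℝ → Vec d) (a b : ℝ) (η : Vec e) (A : Fin d → ℝ → Vec e)
    (c : ℝ → Vec e) (M D : ℝ) (m : ℕ) : Prop where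
  le : a ≤ b
  path : IsLipschitzPath x a b
  cont : ∀ i, ContinuousOn (A i) (Icc a b)
  bound : ∀ i, ∀ u ∈ Icc a b, ‖A i u‖ ≤ M
  eq : ∀ r ∈ Icc a b, c r = η + ∫ u in a..r, ∑ i, deriv x u i • A i u
  approx : ∀ i, ∀ u ∈ Icc a b, ∀ j ≤ m, ‖A i u - V i (c u)‖ ≤ D * pathLength x a b ^ j

variable {V}

/-- Integrating a coefficient error against dx gains one power of the length; the Taylor estimates
below gain their orders this way. -/
lemma norm_drive_sub_expand_le {x : ℝ → Vec d} {a b : ℝ} (hab : a ≤ b)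
    (hx : IsLipschitzPath x a b) {B : Fin d → ℝ → Vec e}
    (hB : ∀ i, ContinuousOn (B i) (Icc a b)) {E : ℕ → (Vec e → Vec e) → Vec e} {m : ℕ}
    {f : Vec e → Vec e} {K : ℝ} (hK : 0 ≤ K)
    (h : ∀ i, ∀ u ∈ Icc a b, ‖B i u - expand V x a E m (lieD (V i) f) u‖ ≤ K)
    {r : ℝ} (hr : r ∈ Icc a b) :
    ‖(E (m + 1) f + ∫ u in a..r, ∑ i, deriv x u i • B i u) - expand V x a E (m + 1) f r‖ ≤
      d * K * pathLength x a b := by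
  have hxr := hx.mono le_rfl hr.2
  have hsub : Icc a r ⊆ Icc a b := Icc_subset_Icc_right hr.2
  rw [expand_succ V hx hr, add_sub_add_left_eq_sub, ← intervalIntegral.integral_sub
    (intervalIntegrable_drive hxr hr.1 fun i => (hB i).mono hsub)
    (intervalIntegrable_drive hxr hr.1 fun i => (continuousOn_expand V hx hab E m _).mono hsub)]
  simp only [← Finset.sum_sub_distrib, ← smul_sub]
  exact norm_drive_le hx hK h hr

/-- The error of the expansion of order `m` along approximate solutions. -/
lemma exists_norm_comp_sub_expand_le {n : ℕ} (hV : ∀ i, Reg n (Vec e) (V i)) {M D : ℝ}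
    (hM : 0 ≤ M) (hD : 0 ≤ D) {m : ℕ} (hm : m ≤ n + 1) {f : Vec e → Vec e}
    (hf : Reg m (Vec e) f) : ∃ C : ℝ, 0 ≤ C ∧ ∀ (x : ℝ → Vec d) (a b : ℝ) (η : Vec e)
      (A : Fin d → ℝ → Vec e) (c : ℝ → Vec e), IsApproxSolution V x a b η A c M D m →
      ∀ r ∈ Icc a b, ‖f (c r) - expand V x a (fun _ g => g η) m f r‖ ≤
        C * pathLength x a b ^ (m + 1) := by
  induction m generalizing f with
  | zero =>
    obtain ⟨L, hL⟩ := hf.exists_lipschitz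
    refine ⟨L * (d * M), by positivity, fun x a b η A c h r hr => ?_⟩
    rw [expand_zero]
    refine (hL.norm_sub_le _ _).trans ?_
    rw [h.eq r hr, add_sub_cancel_left, zero_add, pow_one, mul_assoc]
    exact mul_le_mul_of_nonneg_left (norm_drive_le h.path hM h.bound hr) L.2
  | succ m ih =>
    have hVm : ∀ i, Reg m (Vec e) (V i) := fun i => (hV i).mono (by omega)
    choose C hC0 hC using fun i => ih (by omega) (Reg.lieD (hVm i) hf)
    obtain ⟨L, hL⟩ := hf.2.2.exists_bound
    have hL0 : 0 ≤ L := (norm_nonneg _).trans (hL 0)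
    have hS0 : 0 ≤ ∑ i, C i := Finset.sum_nonneg fun i _ => hC0 i
    refine ⟨d * (L * D + ∑ i, C i), by positivity, fun x a b η A c h r hr => ?_⟩
    have hl := pathLength_nonneg (x := x) h.le
    have hcc : ContinuousOn c (Icc a b) := by
      have h1 := intervalIntegral.continuousOn_primitive_interval'
        (intervalIntegrable_drive h.path h.le h.cont) left_mem_uIcc
      rw [uIcc_of_le h.le] at h1
      exact (continuousOn_const.add h1).congr h.eq
    rw [comp_drive_eq h.path h.le h.cont h.eq hf hr]
    refine (norm_drive_sub_expand_le (K := (L * D + ∑ i, C i) * pathLength x a b ^ (m + 1))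
      (E := fun _ g => g η) h.le h.path
      (fun i => (hf.2.2.continuous.comp_continuousOn hcc).clm_apply (h.cont i)) (by positivity)
      (fun i u hu => ?_) hr).trans_eq (by ring)
    have h1 := hC i x a b η A c ⟨h.le, h.path, h.cont, h.bound, h.eq,
      fun i u hu j hj => h.approx i u hu j (by omega)⟩ u hu
    have h2 : ‖fderiv ℝ f (c u) (A i u - V i (c u))‖ ≤ L * (D * pathLength x a b ^ (m + 1)) :=
      ((fderiv ℝ f (c u)).le_opNorm _).trans
        (mul_le_mul (hL _) (h.approx i u hu _ le_rfl) (norm_nonneg _) hL0)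
    -- The first term is the failure of c to solve the equation, the second the error of order m for
    -- V_i f, which the induction hypothesis controls.
    have e1 : fderiv ℝ f (c u) (A i u) - expand V x a (fun _ g => g η) m (lieD (V i) f) u =
        fderiv ℝ f (c u) (A i u - V i (c u)) +
          (lieD (V i) f (c u) - expand V x a (fun _ g => g η) m (lieD (V i) f) u) := by
      simp [lieD]
    rw [Function.comp_apply, e1]
    refine (norm_add_le_of_le h2 h1).trans ?_
    have h3 := Finset.single_le_sum (fun i _ => hC0 i) (Finset.mem_univ i)
    nlinarith [mul_le_mul_of_nonneg_right h3 (pow_nonneg hl (m + 1))]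

lemma lieD_id (W : Vec e → Vec e) : lieD W (fun y => y) = W := by
  ext1 y
  simp [lieD]

/-- Solutions follow the Euler scheme, up to a power of the length of the driving path. -/
lemma exists_norm_solution_sub_expand_le {n : ℕ} (hV : ∀ i, Reg n (Vec e) (V i)) :
    ∃ C : ℝ, 0 ≤ C ∧ ∀ (x : ℝ → Vec d) (a b : ℝ) (η : Vec e) (w : ℝ → Vec e), a ≤ b →
      IsLipschitzPath x a b → IsSolution V x a b η w →
      ‖w b - expand V x a (fun _ g => g η) (n + 1) (fun y => y) b‖ ≤
        C * pathLength x a b ^ (n + 2) := by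
  choose B hB using fun i => (hV i).exists_bound
  have hB0 : ∀ i, 0 ≤ |B i| := fun i => abs_nonneg _
  -- The identity is unbounded and so not covered by the Taylor estimate. It is applied to V_i
  -- instead, with D = 0 for an exact solution, and integrated once.
  choose C hC0 hC using fun i => exists_norm_comp_sub_expand_le hV
    (M := ∑ i, |B i|) (D := 0) (Finset.sum_nonneg fun i _ => hB0 i) le_rfl n.le_succ (hV i)
  have hS0 : 0 ≤ ∑ i, C i := Finset.sum_nonneg fun i _ => hC0 i
  refine ⟨d * ∑ i, C i, by positivity, fun x a b η w hab hx hw => ?_⟩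
  have hl := pathLength_nonneg (x := x) hab
  have hcont : ∀ i, ContinuousOn (fun u => V i (w u)) (Icc a b) := fun i =>
    (hV i).continuous.comp_continuousOn hw.1
  have h : IsApproxSolution V x a b η (fun i u => V i (w u)) w (∑ i, |B i|) 0 n :=
    ⟨hab, hx, hcont, fun i u _ => ((hB i _).trans (le_abs_self _)).trans
      (Finset.single_le_sum (fun i _ => hB0 i) (Finset.mem_univ i)), hw.2, by simp⟩
  rw [hw.2 b (right_mem_Icc.2 hab)]
  refine (norm_drive_sub_expand_le (K := (∑ i, C i) * pathLength x a b ^ (n + 1))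
    (E := fun _ g => g η) (m := n) (f := fun y => y) (B := fun i u => V i (w u)) hab hx hcont
    (mul_nonneg hS0 (pow_nonneg hl _)) (fun i u hu => ?_)
    (right_mem_Icc.2 hab)).trans_eq (by ring)
  rw [lieD_id]
  refine (hC i x a b η _ w h u hu).trans (mul_le_mul_of_nonneg_right ?_ (by positivity))
  exact Finset.single_le_sum (fun i _ => hC0 i) (Finset.mem_univ i)

lemma exists_wordField_bound {n : ℕ} (hV : ∀ i, Reg n (Vec e) (V i)) :
    ∃ B : ℝ, 0 ≤ B ∧ ∀ k ≤ n, ∀ I : Fin (k + 1) → Fin d,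
      (∀ y, ‖wordField V (k + 1) I y‖ ≤ B) ∧
      ∀ y z, ‖wordField V (k + 1) I y - wordField V (k + 1) I z‖ ≤ B * ‖y - z‖ := by
  have h : ∀ᶠ B : ℝ in Filter.atTop, ∀ k ∈ Finset.range (n + 1), ∀ I : Fin (k + 1) → Fin d,
      (∀ y, ‖wordField V (k + 1) I y‖ ≤ B) ∧
      ∀ y z, ‖wordField V (k + 1) I y - wordField V (k + 1) I z‖ ≤ B * ‖y - z‖ := by
    rw [Filter.eventually_all_finset]
    intro k hk
    rw [Filter.eventually_all]
    intro I
    have hr := Reg.wordField V hV k (Nat.lt_succ_iff.1 (Finset.mem_range.1 hk)) I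
    obtain ⟨B, hB⟩ := hr.exists_bound
    obtain ⟨L, hL⟩ := hr.exists_lipschitz
    filter_upwards [Filter.eventually_ge_atTop B, Filter.eventually_ge_atTop (L : ℝ)] with K h1 h2
    exact ⟨fun y => (hB y).trans h1, fun y z => (hL.norm_sub_le y z).trans
      (mul_le_mul_of_nonneg_right h2 (norm_nonneg _))⟩
  obtain ⟨B, hB, h0⟩ := (h.and (Filter.eventually_ge_atTop 0)).exists
  exact ⟨B, h0, fun k hk I => hB k (Finset.mem_range.2 (Nat.lt_succ_of_le hk)) I⟩

lemma wordOp_eq_wordField (k : ℕ) (I : Fin k → Fin d) (i : Fin d) :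
    wordOp V (V i) k I = wordField V (k + 1) (Fin.snoc (α := fun _ => Fin d) I i) := by
  rw [wordField_eq_wordOp, wordOp_snoc, lieD_id]

/-- The Euler curve `c_r = η + I[η, S(γ)_{0,r}]` is an approximate solution of every order. -/
lemma exists_isApproxSolution_euler {n : ℕ} (hV : ∀ i, Reg n (Vec e) (V i)) {R : ℝ}
    (hR : 1 ≤ R) : ∃ M : ℝ, 0 ≤ M ∧ ∃ D : ℝ, 0 ≤ D ∧ ∀ (γ : ℝ → Vec d) (a b : ℝ) (η : Vec e),
      a ≤ b → IsLipschitzPath γ a b → pathLength γ a b ≤ R →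
      IsApproxSolution V γ a b η (fun i => expand V γ a (fun _ g => g η) n (V i))
        (expand V γ a (fun _ g => g η) (n + 1) fun y => y) M D (n + 1) := by
  obtain ⟨B, hB0, hB⟩ := exists_wordField_bound hV
  set W : ℝ := ∑ k ∈ Finset.range (n + 1), ∑ _I : Fin k → Fin d, R ^ n * B with hW
  have hR0 : 0 ≤ R := by linarith
  have hW0 : 0 ≤ W := by positivity
  -- The bound l ≤ R with R ≥ 1 lets higher powers of the length be absorbed into lower ones.
  have hpow : ∀ l : ℝ, 0 ≤ l → l ≤ R → ∀ j k, j ≤ k → k ≤ n → l ^ k ≤ R ^ n * l ^ j := by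
    intro l hl hlR j k hjk hkn
    obtain ⟨i, rfl⟩ := Nat.exists_eq_add_of_le hjk
    rw [pow_add, mul_comm]
    gcongr
    exact (pow_le_pow_left₀ hl hlR i).trans (pow_le_pow_right₀ hR (by omega))
  have hterm : ∀ (γ : ℝ → Vec d) (a b : ℝ) (η : Vec e), a ≤ b → IsLipschitzPath γ a b →
      pathLength γ a b ≤ R → ∀ i, ∀ u ∈ Icc a b, ∀ (s : Finset ℕ) (j : ℕ),
      s ⊆ Finset.range (n + 1) → (∀ k ∈ s, j ≤ k) →
      ‖∑ k ∈ s, ∑ I : Fin k → Fin d, iterInt γ a k I u • wordOp V (V i) k I η‖ ≤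
        W * pathLength γ a b ^ j := by
    intro γ a b η hab hγ hlR i u hu s j hs hj
    have hl := pathLength_nonneg (x := γ) hab
    rw [hW, Finset.sum_mul]
    refine (norm_sum_le _ _).trans (le_trans (Finset.sum_le_sum fun k hk => ?_)
      (Finset.sum_le_sum_of_subset_of_nonneg hs fun k _ _ => by positivity))
    rw [Finset.sum_mul]
    refine norm_sum_le_of_le _ fun I _ => ?_
    have hkn : k ≤ n := Nat.lt_succ_iff.1 (Finset.mem_range.1 (hs hk))
    rw [norm_smul, wordOp_eq_wordField, Real.norm_eq_abs]
    calc _ ≤ R ^ n * pathLength γ a b ^ j * B :=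
          mul_le_mul ((abs_iterInt_le hγ hab k I hu).trans (hpow _ hl hlR j k (hj k hk) hkn))
            ((hB k hkn _).1 η) (norm_nonneg _) (by positivity)
      _ = _ := by ring
  have hM : ∀ (γ : ℝ → Vec d) (a b : ℝ) (η : Vec e), a ≤ b → IsLipschitzPath γ a b →
      pathLength γ a b ≤ R → ∀ i, ∀ u ∈ Icc a b,
      ‖expand V γ a (fun _ g => g η) n (V i) u‖ ≤ W := by
    intro γ a b η hab hγ hlR i u hu
    simpa [expand] using hterm γ a b η hab hγ hlR i u hu _ 0 (Finset.Subset.refl _) (by simp)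
  refine ⟨W, hW0, ?_⟩
  -- Bootstrap on the order: a curve that solves the equation to order m obeys the Taylor estimate
  -- of order m for V_i, which gives order m + 1. Order 0 is mere boundedness.
  suffices H : ∀ m ≤ n + 1, ∃ D : ℝ, 0 ≤ D ∧ ∀ (γ : ℝ → Vec d) (a b : ℝ) (η : Vec e),
      a ≤ b → IsLipschitzPath γ a b → pathLength γ a b ≤ R →
      IsApproxSolution V γ a b η (fun i => expand V γ a (fun _ g => g η) n (V i))
        (expand V γ a (fun _ g => g η) (n + 1) fun y => y) W D m from H _ le_rfl
  have hbase : ∀ (γ : ℝ → Vec d) (a b : ℝ) (η : Vec e),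
      a ≤ b → IsLipschitzPath γ a b → pathLength γ a b ≤ R → ∀ (m : ℕ) (D : ℝ),
      (∀ i, ∀ u ∈ Icc a b, ∀ j ≤ m, ‖expand V γ a (fun _ g => g η) n (V i) u -
        V i (expand V γ a (fun _ g => g η) (n + 1) (fun y => y) u)‖ ≤
          D * pathLength γ a b ^ j) →
      IsApproxSolution V γ a b η (fun i => expand V γ a (fun _ g => g η) n (V i))
        (expand V γ a (fun _ g => g η) (n + 1) fun y => y) W D m := by
    intro γ a b η hab hγ hlR m D h
    refine ⟨hab, hγ, fun i => continuousOn_expand V hγ hab _ _ _, hM γ a b η hab hγ hlR,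
      fun r hr => ?_, h⟩
    rw [expand_succ V hγ hr]
    simp only [lieD_id]
  intro m
  induction m with
  | zero =>
    intro _
    refine ⟨W + B, by positivity, fun γ a b η hab hγ hlR =>
      hbase γ a b η hab hγ hlR _ _ fun i u hu j hj => ?_⟩
    rw [Nat.le_zero.1 hj, pow_zero, mul_one]
    refine norm_sub_le_of_le (hM γ a b η hab hγ hlR i u hu) ?_
    have h := (hB 0 n.zero_le fun _ => i).1 (expand V γ a (fun _ g => g η) (n + 1) (fun y => y) u)
    simpa [wordField] using h
  | succ m ih =>
    intro hm
    obtain ⟨D, hD0, hD⟩ := ih (by omega)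
    choose C hC0 hC using fun i => exists_norm_comp_sub_expand_le hV hW0 hD0 (by omega)
      ((hV i).mono (Nat.le_of_succ_le_succ hm))
    have hS0 : 0 ≤ ∑ i, C i := Finset.sum_nonneg fun i _ => hC0 i
    refine ⟨D + (W + ∑ i, C i), by positivity, fun γ a b η hab hγ hlR =>
      hbase γ a b η hab hγ hlR _ _ fun i u hu j hj => ?_⟩
    have hl := pathLength_nonneg (x := γ) hab
    have hA := hD γ a b η hab hγ hlR
    rcases hj.lt_or_eq with hj | rfl
    · refine (hA.approx i u hu j (by omega)).trans ?_
      exact mul_le_mul_of_nonneg_right (by linarith) (by positivity)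
    -- The coefficient is first truncated at order m, which drops only iterated integrals of order
    -- above m; the truncation is then compared with V_i along the Euler curve.
    · have h1 := hC i γ a b η _ _ hA u hu
      have h2 : ‖expand V γ a (fun _ g => g η) n (V i) u -
          expand V γ a (fun _ g => g η) m (V i) u‖ ≤ W * pathLength γ a b ^ (m + 1) := by
        rw [expand, expand, ← Finset.sum_Ico_eq_sub _ (by omega : m + 1 ≤ n + 1)]
        refine hterm γ a b η hab hγ hlR i u hu _ _ (fun k hk => ?_) fun k hk => ?_
        · exact Finset.mem_range.2 (Finset.mem_Ico.1 hk).2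
        · exact (Finset.mem_Ico.1 hk).1
      rw [norm_sub_rev] at h1
      refine (norm_sub_le_norm_sub_add_norm_sub _
        (expand V γ a (fun _ g => g η) m (V i) u) _).trans ((add_le_add h2 h1).trans ?_)
      have h3 := Finset.single_le_sum (fun i _ => hC0 i) (Finset.mem_univ i)
      rw [← add_mul]
      exact mul_le_mul_of_nonneg_right (by linarith) (by positivity)

end Approx

/-! ### Euler steps as an almost flow -/

section Flow

variable {d e : ℕ} {V : Fin d → Vec e → Vec e}

/-- The step-`N` signature of `x` over `[s, t]` is that of a path of length at most `l`. -/
def HasShortPath (N : ℕ) (x : ℝ → Vec d) (s t l : ℝ) : Prop :=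
  ∃ γ : ℝ → Vec d, IsLipschitzPath γ 0 1 ∧ pathLength γ 0 1 ≤ l ∧
    ∀ k ≤ N, ∀ I : Fin k → Fin d, iterInt γ 0 k I 1 = iterInt x s k I t

lemma iterInt_eq_of_signature_eq {N : ℕ} {x z : ℝ → Vec d} {s t s' t' : ℝ}
    (h : signature N z s' t' = signature N x s t) {k : ℕ} (hk : k ≤ N) (I : Fin k → Fin d) :
    iterInt z s' k I t' = iterInt x s k I t :=
  congrFun (congrFun h ⟨k, Nat.lt_succ_of_le hk⟩) I

lemma HasShortPath.mono {N : ℕ} {x : ℝ → Vec d} {s t l l' : ℝ} (h : HasShortPath N x s t l)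
    (hl : l ≤ l') : HasShortPath N x s t l' := by
  obtain ⟨γ, h1, h2, h3⟩ := h
  exact ⟨γ, h1, h2.trans hl, h3⟩

lemma HasShortPath.nonneg {N : ℕ} {x : ℝ → Vec d} {s t l : ℝ} (h : HasShortPath N x s t l) :
    0 ≤ l := by
  obtain ⟨γ, h1, h2, h3⟩ := h
  exact (pathLength_nonneg zero_le_one).trans h2

lemma HasShortPath.abs_iterInt_le {N : ℕ} {x : ℝ → Vec d} {s t l : ℝ}
    (h : HasShortPath N x s t l) {k : ℕ} (hk : k ≤ N) (I : Fin k → Fin d) :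
    |iterInt x s k I t| ≤ l ^ k := by
  obtain ⟨γ, h1, h2, h3⟩ := h
  rw [← h3 k hk I]
  exact (EulerRDE.abs_iterInt_le h1 zero_le_one k I (right_mem_Icc.2 zero_le_one)).trans
    (pow_le_pow_left₀ (pathLength_nonneg zero_le_one) h2 k)

/-- The Carnot–Carathéodory norm is an infimum that need not be attained a priori. The slack M + 1,
with s < t, makes the inequality strict and so yields an actual path. -/
lemma hasShortPath_of_holderNorm_le {N : ℕ} {p M : ℝ} (hM : 0 ≤ M) {x : ℝ → Vec d}
    (hx : holderNorm p (signature N x) ≤ ENNReal.ofReal M) {s t : ℝ} (hs : 0 ≤ s) (hst : s < t)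
    (ht : t ≤ 1) : HasShortPath N x s t ((M + 1) * (t - s) ^ (1 / p)) := by
  have hpos : 0 < (t - s) ^ (1 / p) := Real.rpow_pos_of_pos (sub_pos.2 hst) _
  have h1 : ccNorm (signature N x s t) / ENNReal.ofReal ((t - s) ^ (1 / p)) ≤
      ENNReal.ofReal M := by
    refine le_trans ?_ hx
    exact le_iSup_of_le s (le_iSup_of_le t (le_iSup_of_le hs (le_iSup_of_le hst
      (le_iSup_of_le ht le_rfl))))
  rw [ENNReal.div_le_iff (by simpa using hpos) ENNReal.ofReal_ne_top,
    ← ENNReal.ofReal_mul hM] at h1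
  have h2 : ccNorm (signature N x s t) < ENNReal.ofReal ((M + 1) * (t - s) ^ (1 / p)) :=
    h1.trans_lt ((ENNReal.ofReal_lt_ofReal_iff (by positivity)).2 (by nlinarith))
  simp only [ccNorm, iInf_lt_iff] at h2
  obtain ⟨γ, h3, -, h4, h5⟩ := h2
  exact ⟨γ, h3, ((ENNReal.ofReal_lt_ofReal_iff (by positivity)).1 h5).le,
    fun k hk I => iterInt_eq_of_signature_eq h4 hk I⟩

/-- An expansion sees the driving path only through its signature, so x may be traded for any path
sharing it. -/
lemma expand_congr {N m : ℕ} (hm : m ≤ N) {x z : ℝ → Vec d} {s t s' t' : ℝ}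
    (h : ∀ k ≤ N, ∀ I : Fin k → Fin d, iterInt z s' k I t' = iterInt x s k I t)
    (E : ℕ → (Vec e → Vec e) → Vec e) (f : Vec e → Vec e) :
    expand V z s' E m f t' = expand V x s E m f t := by
  refine Finset.sum_congr rfl fun k hk => Finset.sum_congr rfl fun I _ => ?_
  rw [h k ((Nat.lt_succ_iff.1 (Finset.mem_range.1 hk)).trans hm)]

lemma expand_id (x : ℝ → Vec d) (t u : ℝ) (E : ℕ → (Vec e → Vec e) → Vec e) (n : ℕ) :
    expand V x t E (n + 1) (fun y => y) u = E (n + 1) (fun y => y) +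
      ∑ k ∈ Finset.range (n + 1), ∑ I : Fin (k + 1) → Fin d,
        iterInt x t (k + 1) I u • E (n - k) (wordField V (k + 1) I) := by
  rw [expand, Finset.sum_range_succ', add_comm]
  congr 1
  · rw [Fintype.sum_unique]
    simp [iterInt, wordOp]
  · simp only [wordField_eq_wordOp, Nat.add_sub_add_right]

variable (V) in
/-- One step `η + I[η, n + 1, S(x)_{s,t}]` of the Euler scheme. -/
noncomputable def eulerStep (n : ℕ) (x : ℝ → Vec d) (s t : ℝ) (η : Vec e) : Vec e :=
  expand V x s (fun _ g => g η) (n + 1) (fun y => y) t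

lemma eulerStep_eq (n : ℕ) (x : ℝ → Vec d) (s t : ℝ) (η : Vec e) :
    eulerStep V n x s t η = η + ∑ k ∈ Finset.range (n + 1), ∑ I : Fin (k + 1) → Fin d,
        iterInt x s (k + 1) I t • wordField V (k + 1) I η :=
  expand_id x s t _ n

lemma eulerStep_eq_add_eulerIncrement (n : ℕ) (x : ℝ → Vec d) (s t : ℝ) (η : Vec e) :
    eulerStep V n x s t η = η + eulerIncrement V η (signature (n + 1) x s t) := by
  rw [eulerStep_eq, eulerIncrement]
  congr 1
  exact (Fin.sum_univ_eq_sum_range (fun k => ∑ I : Fin (k + 1) → Fin d,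
    iterInt x s (k + 1) I t • wordField V (k + 1) I η) (n + 1)).symm

/-- Every term carries a factor of order l and a bounded Lipschitz field. It matters that the
Lipschitz constant tends to 1 with l: bisection later needs the two halves to contribute a factor
close to 2. -/
lemma exists_eulerStep_lipschitz {n : ℕ} (hV : ∀ i, Reg n (Vec e) (V i)) {R : ℝ} (hR : 1 ≤ R) :
    ∃ C : ℝ, 0 ≤ C ∧ ∀ (x : ℝ → Vec d) (s t l : ℝ), l ≤ R → HasShortPath (n + 1) x s t l →
      ∀ η η' : Vec e,
        ‖eulerStep V n x s t η - eulerStep V n x s t η'‖ ≤ (1 + C * l) * ‖η - η'‖ ∧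
        ‖eulerStep V n x s t η - η‖ ≤ C * l := by
  obtain ⟨B, hB0, hB⟩ := exists_wordField_bound hV
  have hR0 : 0 ≤ R := by linarith
  refine ⟨∑ k ∈ Finset.range (n + 1), ∑ _I : Fin (k + 1) → Fin d, R ^ n * B, by positivity,
    fun x s t l hlR h η η' => ?_⟩
  have hl := h.nonneg
  have hS : ∀ k ≤ n, ∀ I : Fin (k + 1) → Fin d, |iterInt x s (k + 1) I t| ≤ R ^ n * l := by
    intro k hk I
    refine (h.abs_iterInt_le (by omega) I).trans ?_
    rw [pow_succ]
    gcongr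
    exact (pow_le_pow_left₀ hl hlR k).trans (pow_le_pow_right₀ hR hk)
  constructor
  · rw [eulerStep_eq, eulerStep_eq, add_sub_add_comm, one_add_mul]
    refine norm_add_le_of_le le_rfl ?_
    simp only [← Finset.sum_sub_distrib, ← smul_sub, Finset.sum_mul]
    refine norm_sum_le_of_le _ fun k hk => norm_sum_le_of_le _ fun I _ => ?_
    have hk' := Nat.lt_succ_iff.1 (Finset.mem_range.1 hk)
    rw [norm_smul, Real.norm_eq_abs]
    refine (mul_le_mul (hS k hk' I) ((hB k hk' I).2 η η') (norm_nonneg _)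
      (by positivity)).trans_eq (by ring)
  · rw [eulerStep_eq, add_sub_cancel_left]
    simp only [Finset.sum_mul]
    refine norm_sum_le_of_le _ fun k hk => norm_sum_le_of_le _ fun I _ => ?_
    have hk' := Nat.lt_succ_iff.1 (Finset.mem_range.1 hk)
    rw [norm_smul, Real.norm_eq_abs]
    refine (mul_le_mul (hS k hk' I) ((hB k hk' I).1 η) (norm_nonneg _)
      (by positivity)).trans_eq (by ring)

/-- The Euler step is the endpoint of the Euler curve along a short path with the same signature.
The Taylor estimate along that curve gives the error in terms of l, whatever the length of x. -/
lemma exists_norm_wordField_eulerStep_sub_le {n : ℕ} (hV : ∀ i, Reg n (Vec e) (V i)) {R : ℝ}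
    (hR : 1 ≤ R) : ∃ C : ℝ, 0 ≤ C ∧ ∀ (x : ℝ → Vec d) (s t l : ℝ), l ≤ R →
      HasShortPath (n + 1) x s t l → ∀ η : Vec e, ∀ k ≤ n, ∀ I : Fin (k + 1) → Fin d,
      ‖wordField V (k + 1) I (eulerStep V n x s t η) -
        expand V x s (fun _ g => g η) (n - k) (wordField V (k + 1) I) t‖ ≤
          C * l ^ (n - k + 1) := by
  obtain ⟨M, hM, D, hD0, happ⟩ := exists_isApproxSolution_euler hV hR
  have h : ∀ᶠ C : ℝ in Filter.atTop, ∀ k ∈ Finset.range (n + 1), ∀ I : Fin (k + 1) → Fin d,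
      ∀ (x : ℝ → Vec d) (s t l : ℝ), l ≤ R → HasShortPath (n + 1) x s t l → ∀ η : Vec e,
      ‖wordField V (k + 1) I (eulerStep V n x s t η) -
        expand V x s (fun _ g => g η) (n - k) (wordField V (k + 1) I) t‖ ≤
          C * l ^ (n - k + 1) := by
    rw [Filter.eventually_all_finset]
    intro k hk
    rw [Filter.eventually_all]
    intro I
    have hk' := Nat.lt_succ_iff.1 (Finset.mem_range.1 hk)
    obtain ⟨C, hC0, hC⟩ := exists_norm_comp_sub_expand_le hV hM hD0 (by omega)
      (Reg.wordField V hV k hk' I)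
    filter_upwards [Filter.eventually_ge_atTop C] with K hK
    rintro x s t l hlR ⟨γ, h1, h2, h3⟩ η
    have hl := pathLength_nonneg (x := γ) zero_le_one
    have hA := happ γ 0 1 η zero_le_one h1 (h2.trans hlR)
    have h4 := hC γ 0 1 η _ _ ⟨hA.le, hA.path, hA.cont, hA.bound, hA.eq,
      fun i u hu j hj => hA.approx i u hu j (by omega)⟩ 1 (right_mem_Icc.2 zero_le_one)
    rw [expand_congr le_rfl h3, expand_congr (by omega) h3] at h4
    exact h4.trans (mul_le_mul hK (pow_le_pow_left₀ hl h2 _) (pow_nonneg hl _) (hC0.trans hK))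
  obtain ⟨C, hC, h0⟩ := (h.and (Filter.eventually_ge_atTop 0)).exists
  exact ⟨C, h0, fun x s t l hlR hp η k hk I =>
    hC k (Finset.mem_range.2 (Nat.lt_succ_of_le hk)) I x s t l hlR hp η⟩

/-- The Euler steps form an almost flow. -/
lemma exists_norm_eulerStep_eulerStep_sub_le {n : ℕ} (hV : ∀ i, Reg n (Vec e) (V i)) {R : ℝ}
    (hR : 1 ≤ R) : ∃ C : ℝ, 0 ≤ C ∧ ∀ (x : ℝ → Vec d) (s t u l : ℝ), s ≤ t → t ≤ u → l ≤ R →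
      IsLipschitzPath x s u → HasShortPath (n + 1) x s t l → HasShortPath (n + 1) x t u l →
      ∀ η : Vec e, ‖eulerStep V n x t u (eulerStep V n x s t η) - eulerStep V n x s u η‖ ≤
        C * l ^ (n + 2) := by
  obtain ⟨C, hC0, hC⟩ := exists_norm_wordField_eulerStep_sub_le hV hR
  refine ⟨∑ k ∈ Finset.range (n + 1), ∑ _I : Fin (k + 1) → Fin d, C, by positivity,
    fun x s t u l hst htu hlR hx h1 h2 η => ?_⟩
  have hl := h1.nonneg
  -- By Chen, the step over [s, u] is the step over [s, t] plus a sum over words I of S^I_{t,u}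
  -- times the expansion of V_I H over [s, t]. What remains is the Taylor error of each V_I H,
  -- weighted by S^I_{t,u}.
  rw [eulerStep_eq, eulerStep.eq_1 (t := u), ← expand_expand V hst htu hx, expand_id,
    ← eulerStep.eq_1, add_sub_add_left_eq_sub]
  simp only [← Finset.sum_sub_distrib, ← smul_sub, Finset.sum_mul]
  refine norm_sum_le_of_le _ fun k hk => norm_sum_le_of_le _ fun I _ => ?_
  have hk' := Nat.lt_succ_iff.1 (Finset.mem_range.1 hk)
  rw [norm_smul, Real.norm_eq_abs]
  refine (mul_le_mul (h2.abs_iterInt_le (by omega) I) (hC x s t l hlR h1 η k hk' I)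
    (norm_nonneg _) (by positivity)).trans_eq ?_
  rw [show n + 2 = (k + 1) + (n - k + 1) by omega, pow_add]
  ring

end Flow

/-! ### Davie's bisection argument -/

section Sewing

/-- The defect inequality on which Davie's argument rests. -/
structure IsAlmostAdditive (C₀ C₁ α θ : ℝ) (G : ℝ → ℝ → ℝ) : Prop where
  nonneg : ∀ s t, 0 ≤ G s t
  small : ∃ K : ℝ, 0 ≤ K ∧ ∀ s t, 0 ≤ s → s ≤ t → t ≤ 1 → G s t ≤ K * (t - s) ^ θ
  defect : ∀ s t u, 0 ≤ s → s < t → t < u → u ≤ 1 →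
    G s u ≤ G t u + (1 + C₀ * (u - t) ^ α) * G s t + C₁ * (u - s) ^ θ

variable {C₀ C₁ α θ : ℝ} {G : ℝ → ℝ → ℝ}

/-- Bisect: each half carries a factor 2^(-θ), and the defect inequality adds the two halves with
weights 1 and 1 + C₀ (min h 1)^α. -/
lemma IsAlmostAdditive.double (hG : IsAlmostAdditive C₀ C₁ α θ G) (hC₀ : 0 ≤ C₀) (hα : 0 < α)
    (hθ : 1 < θ) {h D : ℝ}
    (H : ∀ s t, 0 ≤ s → s ≤ t → t ≤ 1 → t - s ≤ h → G s t ≤ D * (t - s) ^ θ) {s t : ℝ}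
    (hs : 0 ≤ s) (hst : s ≤ t) (ht : t ≤ 1) (hh : t - s ≤ 2 * h) :
    G s t ≤ ((2 + C₀ * (min h 1) ^ α) * 2 ^ (-θ) * D + C₁) * (t - s) ^ θ := by
  rcases hst.eq_or_lt with rfl | hlt
  · obtain ⟨K, -, hK⟩ := hG.small
    have h0 := hK s s hs le_rfl ht
    rw [sub_self, Real.zero_rpow (by linarith), mul_zero] at h0 ⊢
    exact h0
  have hpos : 0 < t - s := sub_pos.2 hlt
  set r := (s + t) / 2 with hr
  have h1 : r - s = (t - s) / 2 := by rw [hr]; ring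
  have h2 : t - r = (t - s) / 2 := by rw [hr]; ring
  have e : ((t - s) / 2) ^ θ = 2 ^ (-θ) * (t - s) ^ θ := by
    rw [Real.div_rpow hpos.le zero_le_two, Real.rpow_neg zero_le_two]
    ring
  have g1 := H s r hs (by linarith) (by linarith) (by linarith)
  have g2 := H r t (by linarith) (by linarith) ht (by linarith)
  have g3 := hG.defect s r t hs (by linarith) (by linarith) ht
  rw [h1, e] at g1
  rw [h2, e] at g2
  rw [h2] at g3
  have g4 : ((t - s) / 2) ^ α ≤ (min h 1) ^ α :=
    Real.rpow_le_rpow (by linarith) (le_min (by linarith) (by linarith)) hα.le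
  have g5 : (0 : ℝ) ≤ (min h 1) ^ α :=
    Real.rpow_nonneg (le_min (by linarith) zero_le_one) _
  have g6 : (1 + C₀ * ((t - s) / 2) ^ α) * G s r ≤
      (1 + C₀ * (min h 1) ^ α) * (D * (2 ^ (-θ) * (t - s) ^ θ)) := by
    refine mul_le_mul ?_ g1 (hG.nonneg _ _) (by positivity)
    linarith [mul_le_mul_of_nonneg_left g4 hC₀]
  refine g3.trans ((add_le_add_left (add_le_add g2 g6) _).trans_eq ?_)
  ring

/-- As h tends to 0 the factor tends to 2^(1-θ), which is below 1 because θ > 1. -/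
lemma exists_lt_one_of_one_lt (C₀ : ℝ) (hα : 0 < α) (hθ : 1 < θ) :
    ∃ h : ℝ, 0 < h ∧ (2 + C₀ * (min h 1) ^ α) * 2 ^ (-θ) < 1 := by
  have hc : ContinuousAt (fun h : ℝ => (2 + C₀ * (min h 1) ^ α) * 2 ^ (-θ)) 0 := by
    refine ContinuousAt.mul (continuousAt_const.add (continuousAt_const.mul ?_))
      continuousAt_const
    exact (continuous_id.min continuous_const).continuousAt.rpow_const (Or.inr hα.le)
  have h0 : (2 + C₀ * (min (0 : ℝ) 1) ^ α) * 2 ^ (-θ) < 1 := by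
    rw [min_eq_left zero_le_one, Real.zero_rpow hα.ne', mul_zero, add_zero]
    nth_rewrite 1 [← Real.rpow_one 2]
    rw [← Real.rpow_add two_pos]
    exact Real.rpow_lt_one_of_one_lt_of_neg one_lt_two (by linarith)
  have hev := hc.eventually (gt_mem_nhds h0)
  obtain ⟨h, hh⟩ := ((hev.filter_mono nhdsWithin_le_nhds).and
    (self_mem_nhdsWithin (s := Ioi (0 : ℝ)))).exists
  exact ⟨h, hh.2, hh.1⟩

/-- Davie's lemma: the bound does not depend on the constant in `IsAlmostAdditive.small`. -/
lemma exists_forall_isAlmostAdditive_le (hC₀ : 0 ≤ C₀) (hC₁ : 0 ≤ C₁) (hα : 0 < α) (hθ : 1 < θ) :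
    ∃ K : ℝ, 0 ≤ K ∧ ∀ G : ℝ → ℝ → ℝ, IsAlmostAdditive C₀ C₁ α θ G →
      ∀ s t, 0 ≤ s → s ≤ t → t ≤ 1 → G s t ≤ K * (t - s) ^ θ := by
  obtain ⟨h, hh, hq⟩ := exists_lt_one_of_one_lt C₀ hα hθ
  set q := (2 + C₀ * (min h 1) ^ α) * 2 ^ (-θ) with hqdef
  have hmin : ∀ h' : ℝ, 0 < h' → (0 : ℝ) ≤ (min h' 1) ^ α := fun h' hh' =>
    Real.rpow_nonneg (le_min hh'.le zero_le_one) _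
  have hq0 : 0 ≤ q := by
    have := hmin h hh
    positivity
  have hq1 : 0 < 1 - q := by linarith
  have key : ∀ j : ℕ, ∃ K : ℝ, 0 ≤ K ∧ ∀ G : ℝ → ℝ → ℝ, IsAlmostAdditive C₀ C₁ α θ G →
      ∀ s t, 0 ≤ s → s ≤ t → t ≤ 1 → t - s ≤ 2 ^ j * h → G s t ≤ K * (t - s) ^ θ := by
    intro j
    induction j with
    | zero =>
      -- This is the fixed point of D ↦ q D + C₁. Iterating bisection from the non-uniform constant
      -- K₀ leaves q^i K₀, which vanishes in the limit.
      refine ⟨C₁ / (1 - q), by positivity, fun G hG s t hs hst ht hst' => ?_⟩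
      rw [pow_zero, one_mul] at hst'
      obtain ⟨K₀, hK₀, hsmall⟩ := hG.small
      have hiter : ∀ i : ℕ, ∀ s t, 0 ≤ s → s ≤ t → t ≤ 1 → t - s ≤ h →
          G s t ≤ (q ^ i * K₀ + C₁ / (1 - q)) * (t - s) ^ θ := by
        intro i
        induction i with
        | zero =>
          intro s t hs hst ht _
          refine (hsmall s t hs hst ht).trans (mul_le_mul_of_nonneg_right ?_
            (Real.rpow_nonneg (sub_nonneg.2 hst) _))
          have : 0 ≤ C₁ / (1 - q) := by positivity
          linarith
        | succ i ih =>
          intro s t hs hst ht hst'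
          refine (hG.double hC₀ hα hθ ih hs hst ht (by linarith)).trans_eq ?_
          rw [← hqdef]
          congr 1
          field_simp
          ring
      have hlim : Filter.Tendsto (fun i : ℕ => (q ^ i * K₀ + C₁ / (1 - q)) * (t - s) ^ θ)
          Filter.atTop (nhds ((0 * K₀ + C₁ / (1 - q)) * (t - s) ^ θ)) :=
        (((tendsto_pow_atTop_nhds_zero_of_lt_one hq0 hq).mul_const _).add_const _).mul_const _
      rw [zero_mul, zero_add] at hlim
      exact ge_of_tendsto' hlim fun i => hiter i s t hs hst ht hst'
    | succ j ih =>
      obtain ⟨K, hK0, hK⟩ := ih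
      have := hmin (2 ^ j * h) (by positivity)
      refine ⟨(2 + C₀ * (min (2 ^ j * h) 1) ^ α) * 2 ^ (-θ) * K + C₁, by positivity,
        fun G hG s t hs hst ht hst' => hG.double hC₀ hα hθ (hK G hG) hs hst ht ?_⟩
      rw [pow_succ] at hst'
      linarith
  -- Beyond scale h the factor may exceed 1, but j doublings reach length 1, and j depends only on
  -- h.
  obtain ⟨j, hj⟩ := pow_unbounded_of_one_lt (1 / h) one_lt_two
  obtain ⟨K, hK0, hK⟩ := key j
  rw [div_lt_iff₀ hh] at hj
  exact ⟨K, hK0, fun G hG s t hs hst ht => hK G hG s t hs hst ht (by linarith)⟩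

end Sewing

/-! ### The Euler estimate for solutions -/

section Davie

variable {d e : ℕ} {V : Fin d → Vec e → Vec e}

lemma IsSolution.restrict {x : ℝ → Vec d} {y : ℝ → Vec e} {y₀ : Vec e} {a b : ℝ}
    (hV : ∀ i, Continuous (V i)) (hx : IsLipschitzPath x a b) (hy : IsSolution V x a b y₀ y)
    {s t : ℝ} (hs : a ≤ s) (hst : s ≤ t) (ht : t ≤ b) : IsSolution V x s t (y s) y := by
  refine ⟨hy.1.mono (Icc_subset_Icc hs ht), fun r hr => ?_⟩
  have hrb : r ≤ b := hr.2.trans ht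
  have hc : ∀ i, ContinuousOn (fun u => V i (y u)) (Icc a b) := fun i =>
    (hV i).comp_continuousOn hy.1
  rw [hy.2 r ⟨hs.trans hr.1, hrb⟩, hy.2 s ⟨hs, hst.trans ht⟩, add_assoc,
    intervalIntegral.integral_add_adjacent_intervals]
  · exact intervalIntegrable_drive (hx.mono le_rfl (hst.trans ht)) hs
      fun i => (hc i).mono (Icc_subset_Icc_right (hst.trans ht))
  · exact intervalIntegrable_drive (hx.mono hs hrb) hr.1
      fun i => (hc i).mono (Icc_subset_Icc hs hrb)

lemma IsSolution.apply_left {x : ℝ → Vec d} {y : ℝ → Vec e} {y₀ : Vec e} {a b : ℝ}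
    (hab : a ≤ b) (hy : IsSolution V x a b y₀ y) : y a = y₀ := by
  simpa using hy.2 a (left_mem_Icc.2 hab)

lemma mul_rpow_pow {h : ℝ} (hh : 0 ≤ h) (K p : ℝ) (n : ℕ) :
    (K * h ^ (1 / p)) ^ (n + 2) = K ^ (n + 2) * h ^ (((n + 1 : ℕ) + 1 : ℝ) / p) := by
  rw [mul_pow, ← Real.rpow_mul_natCast hh]
  congr 2
  push_cast
  ring

/-- The Euler estimate for solutions driven by paths whose lift is `1/p`-Hölder. -/
lemma exists_norm_sub_eulerStep_le {n : ℕ} (hV : ∀ i, Reg n (Vec e) (V i)) {p M : ℝ}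
    (hp : 1 ≤ p) (hn : p - 1 < ((n + 1 : ℕ) : ℝ)) (hM : 0 ≤ M) :
    ∃ C : ℝ, 0 ≤ C ∧ ∀ x : ℝ → Vec d, IsLipschitzPath x 0 1 →
      holderNorm p (signature (n + 1) x) ≤ ENNReal.ofReal M →
      ∀ (y₀ : Vec e) (y : ℝ → Vec e), IsSolution V x 0 1 y₀ y →
      ∀ s t : ℝ, 0 ≤ s → s ≤ t → t ≤ 1 →
        ‖y t - eulerStep V n x s t (y s)‖ ≤ C * (t - s) ^ (((n + 1 : ℕ) + 1 : ℝ) / p) := by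
  have hp0 : 0 < p := by linarith
  set θ : ℝ := ((n + 1 : ℕ) + 1 : ℝ) / p with hθ
  have hθ1 : 1 < θ := by
    rw [hθ, lt_div_iff₀ hp0]
    linarith
  have hR : 1 ≤ M + 1 := by linarith
  obtain ⟨C₀, hC₀, hlip⟩ := exists_eulerStep_lipschitz hV hR
  obtain ⟨C₁, hC₁, hflow⟩ := exists_norm_eulerStep_eulerStep_sub_le hV hR
  obtain ⟨C₂, hC₂, hsol⟩ := exists_norm_solution_sub_expand_le hV
  have hR0 : 0 ≤ M + 1 := by linarith
  obtain ⟨K, hK0, hK⟩ := exists_forall_isAlmostAdditive_le (C₀ := C₀ * (M + 1))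
    (C₁ := C₁ * (M + 1) ^ (n + 2)) (α := 1 / p) (θ := θ) (by positivity) (by positivity)
    (by positivity) hθ1
  refine ⟨K, hK0, fun x hx hxM y₀ y hy => hK (fun s t => ‖y t - eulerStep V n x s t (y s)‖)
    ⟨fun s t => norm_nonneg _, ?_, ?_⟩⟩
  -- The Lipschitz constant of x enters only here, to provide some finite constant: the Taylor
  -- estimate along x gives (t−s)^(n+2), and θ ≤ n + 2 with t − s ≤ 1.
  · obtain ⟨L, hL0, hL⟩ := hx.exists_pathLength_le
    refine ⟨C₂ * L ^ (n + 2), by positivity, fun s t hs hst ht => ?_⟩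
    have h0 : 0 ≤ t - s := sub_nonneg.2 hst
    refine (hsol x s t (y s) y hst (hx.mono hs ht)
      (hy.restrict (fun i => (hV i).continuous) hx hs hst ht)).trans ?_
    rw [mul_assoc]
    refine mul_le_mul_of_nonneg_left ?_ hC₂
    refine (pow_le_pow_left₀ (pathLength_nonneg hst) (hL s t hs hst ht) _).trans ?_
    rw [mul_pow]
    refine mul_le_mul_of_nonneg_left ?_ (by positivity)
    rw [← Real.rpow_natCast]
    refine Real.rpow_le_rpow_of_exponent_ge' h0 (by linarith) (by linarith) ?_
    rw [hθ, div_le_iff₀ hp0]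
    push_cast
    nlinarith [(n.cast_nonneg : (0 : ℝ) ≤ n)]
  · intro s t u hs hst htu hu
    have hle : ∀ r : ℝ, 0 ≤ r → r ≤ 1 → (M + 1) * r ^ (1 / p) ≤ M + 1 := fun r h0 h1 =>
      mul_le_of_le_one_right hR0 (Real.rpow_le_one h0 h1 (by positivity))
    have hmono : ∀ r : ℝ, 0 ≤ r → r ≤ u - s →
        (M + 1) * r ^ (1 / p) ≤ (M + 1) * (u - s) ^ (1 / p) := fun r h0 h1 =>
      mul_le_mul_of_nonneg_left (Real.rpow_le_rpow h0 h1 (by positivity)) hR0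
    have hst' := hasShortPath_of_holderNorm_le hM hxM hs hst (by linarith)
    have htu' := hasShortPath_of_holderNorm_le hM hxM (by linarith : 0 ≤ t) htu hu
    have g1 := (hlip x t u _ (hle _ (by linarith) (by linarith)) htu' (y t)
      (eulerStep V n x s t (y s))).1
    have g2 := hflow x s t u _ hst.le htu.le (hle (u - s) (by linarith) (by linarith))
      (hx.mono hs hu) (hst'.mono (hmono _ (by linarith) (by linarith)))
      (htu'.mono (hmono _ (by linarith) (by linarith))) (y s)
    rw [mul_rpow_pow (by linarith)] at g2
    rw [← mul_assoc] at g1 g2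
    -- Insert Φ_{t,u}(y_t) and Φ_{t,u}(Φ_{s,t}(y_s)) between y_u and Φ_{s,u}(y_s): the gaps are
    -- G_{t,u}, a Lipschitz multiple of G_{s,t}, and the almost flow error.
    refine (norm_sub_le_norm_sub_add_norm_sub _
      (eulerStep V n x t u (eulerStep V n x s t (y s))) _).trans (add_le_add ?_ g2)
    exact (norm_sub_le_norm_sub_add_norm_sub _
      (eulerStep V n x t u (y t)) _).trans (add_le_add le_rfl g1)

end Davie

end EulerRDE

/-! ### The generalized Davie lemma -/

theorem lemma3p2 {d e : ℕ} (p : ℝ) (hp : 1 ≤ p) (N : ℕ) (hN : p - 1 < (N : ℝ))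
    (V : Fin d → Vec e → Vec e) (hV : ∀ i, IsLip N (V i))
    (M₁ M₂ : ℝ) (hM₁ : 0 ≤ M₁) :
    (∃ C : ℝ, 0 < C ∧
      ∀ x : ℝ → Vec d, IsLipschitzPath x 0 1 →
        holderNorm p (signature N x) ≤ ENNReal.ofReal M₁ →
      ∀ y₀ : Vec e, ‖y₀‖ ≤ M₂ → ∀ y : ℝ → Vec e, IsSolution V x 0 1 y₀ y →
      ∀ s t : ℝ, 0 ≤ s → s ≤ t → t ≤ 1 →
        (s < t → ‖y t - y s‖ < C * (t - s) ^ (1 / p)) ∧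
        ‖(y t - y s) - eulerIncrement V (y s) (signature N x s t)‖
          ≤ C * (t - s) ^ (((N : ℝ) + 1) / p)) ∧
    (∀ K : ℝ, 0 < K → ∃ C' : ℝ, 0 < C' ∧
      ∀ x : ℝ → Vec d, IsLipschitzPath x 0 1 →
        holderNorm p (signature N x) ≤ ENNReal.ofReal M₁ →
      ∀ y₀ : Vec e, ‖y₀‖ ≤ M₂ → ∀ y : ℝ → Vec e, IsSolution V x 0 1 y₀ y →
      ∀ s t : ℝ, 0 ≤ s → s ≤ t → t ≤ 1 →
      ∀ z : ℝ → Vec d, IsLipschitzPath z s t →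
        signature N z s t = signature N x s t →
        pathLength z s t ≤ K * M₁ * (t - s) ^ (1 / p) →
      ∀ w : ℝ → Vec e, IsSolution V z s t (y s) w →
        ‖(y t - y s) - (w t - w s)‖ ≤ C' * (t - s) ^ (((N : ℝ) + 1) / p)) := by
  have hp0 : 0 < p := by linarith
  obtain ⟨n, rfl⟩ : ∃ n, N = n + 1 := by
    refine Nat.exists_eq_succ_of_ne_zero ?_
    rintro rfl
    norm_num at hN
    linarith
  have hV' : ∀ i, Reg n (Vec e) (V i) := fun i => (hV i).reg
  have hR : 1 ≤ M₁ + 1 := by linarith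
  obtain ⟨C, hC0, hC⟩ := exists_norm_sub_eulerStep_le hV' hp hN hM₁
  obtain ⟨C₀, hC₀, hlip⟩ := exists_eulerStep_lipschitz hV' hR
  -- The remainder costs C and the Euler increment C₀ (M₁ + 1); the extra 1 makes the first
  -- inequality strict.
  refine ⟨⟨C + C₀ * (M₁ + 1) + 1, by positivity, fun x hx hxM y₀ _ y hy s t hs hst ht =>
    ⟨fun hlt => ?_, ?_⟩⟩, fun K hK => ?_⟩
  · have hpos : 0 < t - s := sub_pos.2 hlt
    have h1 := hC x hx hxM y₀ y hy s t hs hst ht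
    have h2 := (hlip x s t _ (mul_le_of_le_one_right (by linarith)
      (Real.rpow_le_one hpos.le (by linarith) (by positivity)))
      (hasShortPath_of_holderNorm_le hM₁ hxM hs hlt ht) (y s) (y s)).2
    have h3 : (t - s) ^ (((n + 1 : ℕ) + 1 : ℝ) / p) ≤ (t - s) ^ (1 / p) := by
      refine Real.rpow_le_rpow_of_exponent_ge hpos (by linarith) ?_
      gcongr
      push_cast
      linarith [(n.cast_nonneg : (0 : ℝ) ≤ n)]
    have h4 := norm_sub_le_norm_sub_add_norm_sub (y t) (eulerStep V n x s t (y s)) (y s)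
    have h5 := mul_le_mul_of_nonneg_left h3 hC0
    have h6 : 0 < (t - s) ^ (1 / p) := Real.rpow_pos_of_pos hpos _
    linarith
  · have h1 := hC x hx hxM y₀ y hy s t hs hst ht
    rw [eulerStep_eq_add_eulerIncrement, ← sub_sub] at h1
    refine h1.trans (mul_le_mul_of_nonneg_right ?_ (Real.rpow_nonneg (sub_nonneg.2 hst) _))
    have : 0 ≤ C₀ * (M₁ + 1) := by positivity
    linarith
  · obtain ⟨C₂, hC₂, hsol⟩ := exists_norm_solution_sub_expand_le hV'
    refine ⟨C + C₂ * (K * M₁) ^ (n + 2) + 1, by positivity,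
      fun x hx hxM y₀ _ y hy s t hs hst ht z hz hsig hlen w hw => ?_⟩
    have h0 : 0 ≤ t - s := sub_nonneg.2 hst
    have h1 := hC x hx hxM y₀ y hy s t hs hst ht
    have h2 := hsol z s t (y s) w hst hz hw
    -- Equal signatures turn the Euler step along z into that along x, which then serves as the
    -- intermediate point between y_t and w_t.
    rw [expand_congr le_rfl (fun k hk I => iterInt_eq_of_signature_eq hsig hk I)] at h2
    have h3 := pow_le_pow_left₀ (pathLength_nonneg hst) hlen (n + 2)
    rw [mul_rpow_pow h0] at h3
    have h4 := mul_le_mul_of_nonneg_left h3 hC₂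
    have h5 : 0 ≤ (t - s) ^ (((n + 1 : ℕ) + 1 : ℝ) / p) := Real.rpow_nonneg h0 _
    rw [hw.apply_left hst, sub_sub_sub_cancel_right]
    have h6 := norm_sub_le_norm_sub_add_norm_sub (y t) (eulerStep V n x s t (y s)) (w t)
    rw [norm_sub_rev (eulerStep V n x s t (y s))] at h6
    rw [eulerStep] at h1 h6
    linarith
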